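/- **Setting.** Let $\mathcal X$ (contexts) and $\mathcal Y$ (arms) be non-empty sets, $\mathcal P=\mathcal X\times\mathcal Y$, and let $D$ be a (pseudo)metric on $\mathcal P$ with $D\le 1$. Let $d_r\ge 1$, and let the expected rewards $\mu_y(x)=(\mu^1_y(x),\dots,\mu^{d_r}_y(x))\in\mathbb R^{d_r}$ satisfy $|\mu^i_y(x)-\mu^i_{y'}(x')|\le D((x,y),(x',y'))$ for all $i$ and all pairs. A vector $a$ is dominated by $b$ ($a\prec b$) if $a^i\le b^i$ for all $i$ and $a^i<b^i$ for some $i$; two vectors are incomparable if neither is dominated by the other. $\mathcal O(x)$ is the set of arms $y$ such that $\mu_y(x)\not\prec\mu_{y'}(x)$ for all $y'\in\mathcal Y$. The Pareto suboptimality gap is $$\Delta_y(x)=\inf\{\varepsilon\ge 0:\ \mu_y(x)+(\varepsilon,\dots,\varepsilon)\text{ is incomparable with }\mu_{y'}(x)\text{ for all }y'\in\mathcal O(x)\}\qquad(\inf\emptyset=\infty),$$ and $C_{\max}=\sup_{(x,y)\in\mathcal P}\Delta_y(x)\in[0,\infty]$. For $r>0$ let $N_r$ be the supremum of the cardinalities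 of the sets $Q\subseteq\{(x,y)\in\mathcal P:\Delta_y(x)\le 12r\}$ whose distinct points are at distance $\ge r$; for $p>0$ let $d_p=\inf\{a>0: N_r\le p\,r^{-a}\ \forall r\in(0,1)\}\in[0,\infty]$. **Protocol.** The contexts $x_1,\dots,x_T$ ($T\ge1$) are fixed beforehand. In round $t$ the learner observes $x_t$, plays an arm $y_t$ and receives $r_t=\mu_{y_t}(x_t)+\kappa_t$, where the noise is conditionally 1-sub-Gaussian in each objective: $\mathbb E[e^{\lambda\kappa^i_t}\mid\mathcal H_t]\le e^{\lambda^2/2}$ for all $\lambda\in\mathbb R$ and all $i$, with $\mathcal H_t$ generated by $y_1,\dots,y_t$, $\kappa_1,\dots,\kappa_{t-1}$ and the learner's choices of balls in rounds $1,\dots,t$ (see below). The Pareto regret is $\mathrm{Reg}(T)=\sum_{t=1}^T\Delta_{y_t}(x_t)$. **Algorithm PCZ** (Pareto Contextual Zooming) with confidence parameter $\delta$. It keeps a finite collection $\mathcal B$ of active closed balls $B$ with center in $\mathcal P$, radius $r(B)$, counter $N_B$ and estimates $\hat\mu^i_B$; initially one ball of radius $1$ with arbitrary center. A new ball has $N_B=0$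 and $\hat\mu_B^i=0$. The domain $\mathrm{dom}(B)$ is $B$ minus all active balls of radius $<r(B)$. Put $A=1+2\log(2\sqrt2\,d_rT^{3/2}/\delta)$, $u_B=\sqrt{2A/N_B}$ ($=\infty$ if $N_B=0$), and $$g_B^i=r(B)+\min_{B'\in\mathcal B}\bigl(\hat\mu^i_{B'}+u_{B'}+r(B')+D(B',B)\bigr),$$ $D(B',B)$ being the distance of the centers. In round $t$, let $\hat{\mathcal R}$ be the set of active balls whose domain contains $(x_t,y)$ for some $y$, and $\hat{\mathcal A}^*$ the set of $B\in\hat{\mathcal R}$ with $g_B\not\prec g_{B'}$ for all $B'\in\hat{\mathcal R}$. Draw $y_t$ uniformly from $S_t=\{y:(x_t,y)\in\bigcup_{B\in\hat{\mathcal A}^*}\mathrm{dom}(B)\}$ (uniformly with respect to a fixed reference measure on $\mathcal Y$; if $S_t$ has reference measure $0$ or $\infty$, draw $y_t$ from $S_t$ in any way); draw $\hat B$ uniformly from the balls in $\hat{\mathcal A}^*$ whose domain contains $(x_t,y_t)$; if $u_{\hat B}\le r(\hat B)$, activate a new ball with center $(x_t,y_t)$ and radius $r(\hat B)/2$; then replace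 $\hat\mu^i_{\hat B}$ by $(\hat\mu^i_{\hat B}N_{\hat B}+r^i_t)/(N_{\hat B}+1)$ and $N_{\hat B}$ by $N_{\hat B}+1$. **Statement.** Run PCZ for $T$ rounds with $\delta=1/T$. Then for every $p>0$ $$\mathbb E[\mathrm{Reg}(T)]\ \le\ \Bigl(28+112\,p\,\log\bigl(2\sqrt2\,d_r\,T^{5/2}e\bigr)\Bigr)\,T^{\frac{1+d_p}{2+d_p}}+C_{\max},$$ where the exponent is read as $1$ if $d_p=\infty$. -/

import Mathlib

open MeasureTheory ProbabilityTheory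
open scoped ENNReal NNReal

noncomputable section

namespace PCZ

/-! ### Pareto order, Pareto front, Pareto suboptimality gap -/

/-- The vector `a` is dominated by the vector `b`: `a ≤ b` in every objective and `a < b` in
at least one of them. -/
def Dominated {ι α : Type*} [Preorder α] (a b : ι → α) : Prop :=
  (∀ i, a i ≤ b i) ∧ ∃ i, a i < b i

/-- Neither vector dominates the other. -/
def Incomparable {ι α : Type*} [Preorder α] (a b : ι → α) : Prop :=
  ¬ Dominated a b ∧ ¬ Dominated b a

variable {X Y : Type*} {d : ℕ}

/-- The Pareto front at the context `x`: the arms that no arm dominates, given `x`.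
Here `μ (x, y) i` is the expected reward of the arm `y` in objective `i` for the context `x`. -/
def paretoFront (μ : X × Y → Fin d → ℝ) (x : X) : Set Y :=
  {y | ∀ y' : Y, ¬ Dominated (μ (x, y)) (μ (x, y'))}

/-- The Pareto suboptimality gap of the context-arm pair `z = (x, y)`: the infimum of the `ε ≥ 0`
such that `μ (x, y) + (ε, …, ε)` is incomparable with `μ (x, y')` for all `y'` in the
Pareto front at `x` (it is `∞` if there is no such `ε`). -/
def gap (μ : X × Y → Fin d → ℝ) (z : X × Y) : ℝ≥0∞ :=
  ⨅ (ε : ℝ≥0) (_ : ∀ y' ∈ paretoFront μ z.1,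
    Incomparable (fun i => μ z i + (ε : ℝ)) (μ (z.1, y'))), (ε : ℝ≥0∞)

/-- The supremum of the Pareto suboptimality gap over all context-arm pairs. -/
def maxGap (μ : X × Y → Fin d → ℝ) : ℝ≥0∞ := ⨆ z : X × Y, gap μ z

/-! ### Similarity space and Pareto zooming dimension -/

/-- `D` is a (pseudo)metric on the set of context-arm pairs, bounded by `1`. -/
structure IsSimilarity (D : X × Y → X × Y → ℝ) : Prop where
  self : ∀ z, D z z = 0
  symm : ∀ z z', D z z' = D z' z
  triangle : ∀ z z' z'', D z z'' ≤ D z z' + D z' z''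
  le_one : ∀ z z', D z z' ≤ 1

/-- The `r`-packing number of `S`: the largest cardinality of a subset of `S` whose distinct points
are at distance at least `r`. -/
def packingNumber (D : X × Y → X × Y → ℝ) (r : ℝ) (S : Set (X × Y)) : ℕ∞ :=
  ⨆ (Q : Set (X × Y)) (_ : Q ⊆ S ∧ ∀ z ∈ Q, ∀ z' ∈ Q, z ≠ z' → r ≤ D z z'), Q.encard

/-- The Pareto `r`-zooming number: the `r`-packing number of the set of the pairs whose gap is
at most `12 r`. -/
def zoomingNumber (D : X × Y → X × Y → ℝ) (μ : X × Y → Fin d → ℝ) (r : ℝ) : ℕ∞ :=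
  packingNumber D r {z | gap μ z ≤ ENNReal.ofReal (12 * r)}

/-- The Pareto zooming dimension for the constant `p`; it is `∞` if no exponent is admissible. -/
def zoomingDim (D : X × Y → X × Y → ℝ) (μ : X × Y → Fin d → ℝ) (p : ℝ) : ℝ≥0∞ :=
  ⨅ (a : ℝ) (_ : 0 < a ∧ ∀ r ∈ Set.Ioo (0 : ℝ) 1,
    (zoomingNumber D μ r : ℝ≥0∞) ≤ ENNReal.ofReal (p * r ^ (-a))), ENNReal.ofReal a

/-- `(1 + a) / (2 + a)`, with the limit value `1` at `a = ∞`. -/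
def regretExponent (a : ℝ≥0∞) : ℝ :=
  if a = ∞ then 1 else (1 + a.toReal) / (2 + a.toReal)

/-! ### The algorithm: its deterministic part -/

/-- The data kept by the algorithm. The active balls are numbered `0, …, numBalls - 1` in the order
of their creation; the ball `k` has a center, a radius, a counter (number of times it has been
chosen) and one mean reward estimate per objective. Values at `k ≥ numBalls` are irrelevant. -/
structure State (X Y : Type*) (d : ℕ) where
  numBalls : ℕ
  center : ℕ → X × Y
  radius : ℕ → ℝ
  count : ℕ → ℕ
  est : ℕ → Fin d → ℝ

/-- Initially there is one active ball, of radius `1`, with center `z₀` and no sample. -/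
def State.init (d : ℕ) (z₀ : X × Y) : State X Y d where
  numBalls := 1
  center := fun _ => z₀
  radius := fun _ => 1
  count := fun _ => 0
  est := fun _ _ => 0

/-- The (closed) ball number `k`. -/
def State.ball (D : X × Y → X × Y → ℝ) (s : State X Y d) (k : ℕ) : Set (X × Y) :=
  {z | D z (s.center k) ≤ s.radius k}

/-- The domain of ball `k`: the ball minus all active balls of strictly smaller radius. -/
def State.dom (D : X × Y → X × Y → ℝ) (s : State X Y d) (k : ℕ) : Set (X × Y) :=
  {z | z ∈ s.ball D k ∧ ∀ j < s.numBalls, s.radius j < s.radius k → z ∉ s.ball D j}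

/-- The confidence parameter `1 + 2 log (2 √2 d T^{3/2} / δ)`. -/
def confA (d T : ℕ) (δ : ℝ) : ℝ :=
  1 + 2 * Real.log (2 * √2 * d * (T : ℝ) ^ (3 / 2 : ℝ) / δ)

/-- The sample uncertainty `√(2 A / N_B)` of ball `k`, infinite as long as it has no sample. -/
def State.unc (T : ℕ) (δ : ℝ) (s : State X Y d) (k : ℕ) : EReal :=
  if s.count k = 0 then ⊤ else ((√(2 * confA d T δ / s.count k) : ℝ) : EReal)

/-- The pre-index: mean estimate plus sample uncertainty plus radius. -/
def State.preIndex (T : ℕ) (δ : ℝ) (s : State X Y d) (k : ℕ) (i : Fin d) : EReal :=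
  (s.est k i : EReal) + s.unc T δ k + (s.radius k : EReal)

/-- The index: radius plus the minimum over the active balls `j` of the pre-index of `j` plus the
distance between the centers. -/
def State.index (D : X × Y → X × Y → ℝ) (T : ℕ) (δ : ℝ) (s : State X Y d) (k : ℕ) (i : Fin d) :
    EReal :=
  (s.radius k : EReal) + (Finset.range s.numBalls).inf
    (fun j => s.preIndex T δ j i + (D (s.center j) (s.center k) : EReal))

/-- The active balls relevant to the context `x`. -/
def State.relevant (D : X × Y → X × Y → ℝ) (s : State X Y d) (x : X) : Set ℕ :=
  {k | k < s.numBalls ∧ ∃ y : Y, (x, y) ∈ s.dom D k}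

/-- The relevant balls whose index is not dominated by the index of a relevant ball. -/
def State.optimal (D : X × Y → X × Y → ℝ) (T : ℕ) (δ : ℝ) (s : State X Y d) (x : X) : Set ℕ :=
  {k | k ∈ s.relevant D x ∧
    ∀ j ∈ s.relevant D x, ¬ Dominated (s.index D T δ k) (s.index D T δ j)}

/-- The set from which the arm is drawn. -/
def State.armSet (D : X × Y → X × Y → ℝ) (T : ℕ) (δ : ℝ) (s : State X Y d) (x : X) : Set Y :=
  {y | ∃ k ∈ s.optimal D T δ x, (x, y) ∈ s.dom D k}

/-- The set from which the ball is drawn, once the arm `y` has been played. -/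
def State.candidates (D : X × Y → X × Y → ℝ) (T : ℕ) (δ : ℝ) (s : State X Y d) (x : X) (y : Y) :
    Set ℕ :=
  {k | k ∈ s.optimal D T δ x ∧ (x, y) ∈ s.dom D k}

open Classical in
/-- Activation of a new ball, with center `z` and half the radius of the chosen ball `k`, if the
sample uncertainty of `k` is at most its radius. -/
def State.activate (T : ℕ) (δ : ℝ) (s : State X Y d) (z : X × Y) (k : ℕ) : State X Y d :=
  if s.unc T δ k ≤ (s.radius k : EReal) then
    { numBalls := s.numBalls + 1
      center := Function.update s.center s.numBalls z
      radius := Function.update s.radius s.numBalls (s.radius k / 2)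
      count := Function.update s.count s.numBalls 0
      est := Function.update s.est s.numBalls 0 }
  else s

/-- Update of the mean estimates and of the counter of the chosen ball `k` with the reward `ρ`. -/
def State.record (s : State X Y d) (ρ : Fin d → ℝ) (k : ℕ) : State X Y d :=
  { s with
    count := Function.update s.count k (s.count k + 1)
    est := Function.update s.est k (fun i => (s.est k i * s.count k + ρ i) / (s.count k + 1)) }

/-- The end of a round in which the pair `z` was played, the reward `ρ` was observed and the
ball `k` was chosen. -/
def State.next (T : ℕ) (δ : ℝ) (s : State X Y d) (z : X × Y) (ρ : Fin d → ℝ) (k : ℕ) :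
    State X Y d :=
  (s.activate T δ z k).record ρ k

/-- The state before round `t` (rounds are numbered `0, …, T - 1`), for the contexts `x`, the arms
`y`, the noise vectors `κ` and the chosen balls `b`; the reward in round `s` is
`μ (x s, y s) + κ s`. -/
def stateAt (μ : X × Y → Fin d → ℝ) (z₀ : X × Y) (T : ℕ) (δ : ℝ) (x : ℕ → X) (y : ℕ → Y)
    (κ : ℕ → Fin d → ℝ) (b : ℕ → ℕ) : ℕ → State X Y d
  | 0 => State.init d z₀
  | t + 1 => (stateAt μ z₀ T δ x y κ b t).next T δ (x t, y t)
      (fun i => μ (x t, y t) i + κ t i) (b t)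

/-! ### The algorithm: its random part -/

section Random

variable {Ω : Type*} [MeasurableSpace Y]

/-- The information before the arm of round `t` is drawn: the arms, noise vectors and chosen balls
of the rounds before `t`. -/
abbrev preArm (y : ℕ → Ω → Y) (κ : ℕ → Ω → Fin d → ℝ) (b : ℕ → Ω → ℕ) (t : ℕ) :
    MeasurableSpace Ω :=
  ⨆ s : Fin t, (MeasurableSpace.comap (y s) inferInstance ⊔
    MeasurableSpace.comap (κ s) inferInstance ⊔ MeasurableSpace.comap (b s) inferInstance)

/-- The previous information together with the arm of round `t`. -/
abbrev preBall (y : ℕ → Ω → Y) (κ : ℕ → Ω → Fin d → ℝ) (b : ℕ → Ω → ℕ) (t : ℕ) :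
    MeasurableSpace Ω :=
  preArm y κ b t ⊔ MeasurableSpace.comap (y t) inferInstance

/-- The previous information together with the ball of round `t`. The draw of the ball makes no use
of the reward of round `t`, so it may be counted as preceding the observation of this reward. -/
abbrev preNoise (y : ℕ → Ω → Y) (κ : ℕ → Ω → Fin d → ℝ) (b : ℕ → Ω → ℕ) (t : ℕ) :
    MeasurableSpace Ω :=
  preBall y κ b t ⊔ MeasurableSpace.comap (b t) inferInstance

/-- The state before round `t`, as a function of the outcome `ω`. -/
def randomState (μ : X × Y → Fin d → ℝ) (z₀ : X × Y) (T : ℕ) (δ : ℝ) (x : ℕ → X)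
    (y : ℕ → Ω → Y) (κ : ℕ → Ω → Fin d → ℝ) (b : ℕ → Ω → ℕ) (t : ℕ) (ω : Ω) : State X Y d :=
  stateAt μ z₀ T δ x (fun s => y s ω) (fun s => κ s ω) (fun s => b s ω) t

open Classical in
/-- On the probability space `(Ω, P)`, the arms `y`, the noise vectors `κ` and the numbers `b` of
the chosen balls form a run of the algorithm with horizon `T` and confidence parameter `δ`, for the
contexts `x` and the first center `z₀`, in an environment with conditionally `1`-sub-Gaussian noise.
"Uniformly at random" refers, for arms, to the reference measure `ν` on the arm set (such as a
counting or a Lebesgue measure): the law is `ν` conditioned on the set from which the arm is drawn.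
If that set has `ν`-measure `0` or `∞`, so that `ν` yields no uniform law on it, the arm
may be drawn from it in any way. -/
structure IsRun [MeasurableSpace Ω] (D : X × Y → X × Y → ℝ) (μ : X × Y → Fin d → ℝ) (z₀ : X × Y)
    (T : ℕ) (δ : ℝ) (x : ℕ → X) (ν : Measure Y) (P : Measure Ω)
    (y : ℕ → Ω → Y) (κ : ℕ → Ω → Fin d → ℝ) (b : ℕ → Ω → ℕ) : Prop where
  measurable_arm : ∀ t, Measurable (y t)
  measurable_noise : ∀ t, Measurable (κ t)
  measurable_ball : ∀ t, Measurable (b t)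
  /-- The arm is drawn from the union of the domains of the Pareto optimal balls. -/
  arm_mem : ∀ t < T, ∀ᵐ ω ∂P,
    y t ω ∈ (randomState μ z₀ T δ x y κ b t ω).armSet D T δ (x t)
  /-- The arm is drawn uniformly. -/
  arm_uniform : ∀ t < T, ∀ A : Set Y, MeasurableSet A → ∀ᵐ ω ∂P,
    ν ((randomState μ z₀ T δ x y κ b t ω).armSet D T δ (x t)) ≠ 0 →
    ν ((randomState μ z₀ T δ x y κ b t ω).armSet D T δ (x t)) ≠ ∞ →
      (P[fun ω' => if y t ω' ∈ A then (1 : ℝ) else 0 | preArm y κ b t]) ω =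
        (ν[|(randomState μ z₀ T δ x y κ b t ω).armSet D T δ (x t)]).real A
  /-- Exponential moments of the noise exist. -/
  noise_integrable : ∀ t < T, ∀ (i : Fin d) (l : ℝ),
    Integrable (fun ω => Real.exp (l * κ t ω i)) P
  /-- The noise is conditionally `1`-sub-Gaussian in each objective, given the past arms and noise
  vectors, the present arm, and the learner's own draws of balls. -/
  noise_subGaussian : ∀ t < T, ∀ (i : Fin d) (l : ℝ), ∀ᵐ ω ∂P,
    (P[fun ω' => Real.exp (l * κ t ω' i) | preNoise y κ b t]) ω ≤ Real.exp (l ^ 2 / 2)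
  /-- The ball is drawn uniformly from the Pareto optimal balls whose domain contains the pair
  that was played. -/
  ball_uniform : ∀ t < T, ∀ k : ℕ, ∀ᵐ ω ∂P,
    (P[fun ω' => if b t ω' = k then (1 : ℝ) else 0 | preBall y κ b t]) ω =
      if k ∈ (randomState μ z₀ T δ x y κ b t ω).candidates D T δ (x t) (y t ω) then
        ((((randomState μ z₀ T δ x y κ b t ω).candidates D T δ (x t) (y t ω)).ncard : ℝ))⁻¹
      else 0

end Random

/-- The Pareto regret after `T` rounds for the contexts `x` and the arms `y`. -/
def regret (μ : X × Y → Fin d → ℝ) (T : ℕ) (x : ℕ → X) (y : ℕ → Y) : ℝ≥0∞ :=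
  ∑ t ∈ Finset.range T, gap μ (x t, y t)

end PCZ

end

namespace PCZ

variable {X Y : Type*} {d : ℕ}

/-! ### The Pareto suboptimality gap -/

/-! The argument is optimism plus packing. Suppose that the noise collected by each active ball
stays within its confidence bound. Then the index of a ball bounds the rewards on the whole ball
from above (`Invariant.le_index`), and it exceeds the true rewards by only a multiple of the radius
`r`, because the parent ball was sampled until its uncertainty fell below its radius `2r`
(`Invariant.index_le`). The chosen ball is not dominated by the ball covering a competing arm, so
that arm is, in some objective, at most `O(r)` better than the arm played. Hence the gap is at most
`14 r`, and at most `6 r` if the chosen ball itself has small uncertainty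
(`Invariant.gap_le_of_index_le`).

A new center lies outside all balls of its own radius, and its gap is at most 12 times that radius.
The balls of radius `2⁻ⁿ`, `n ≥ 1`, are therefore counted by the zooming number. Each round is
charged to one ball, and a ball of radius `r` receives at most `2 + 2A/r²` rounds
(`card_chargedBall_le`). Balls of radius below `r₀` cost at most `14 r₀ T` in all; the others form a
geometric sum, at most `112 p L r₀^(-(1+a))` with `A = 2L - 1` (`regret_le_of_noiseBounded`). The
choice `r₀ = T^(-1/(2+a))` balances the two.

The noise bounds fail with probability at most `1/T`, by exponential supermartingales and a union
bound (`IsRun.measure_not_noiseBounded_le`). A failure costs at most `T · maxGap`, which yields the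
additive term. -/

lemma exists_le_of_not_dominated {ι α : Type*} [LinearOrder α] [Nonempty ι] {a b : ι → α}
    (h : ¬ Dominated a b) : ∃ i, b i ≤ a i := by
  by_contra! hc
  exact h ⟨fun i => (hc i).le, Classical.arbitrary ι, hc _⟩

/-- A finite gap is at most `c` as soon as each point of the front exceeds `μ z + c` weakly in no
more than all but one objective. -/
lemma gap_le_of_forall_exists (hd : 0 < d) {μ : X × Y → Fin d → ℝ} {z : X × Y} (hz : gap μ z ≠ ⊤)
    {c : ℝ} (hc : 0 ≤ c)
    (h : ∀ y' ∈ paretoFront μ z.1, ∃ i, μ (z.1, y') i ≤ μ z i + c) :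
    gap μ z ≤ ENNReal.ofReal c := by
  by_contra! hlt
  obtain ⟨e, hce, heg⟩ := ENNReal.lt_iff_exists_nnreal_btwn.1 hlt
  have hce' : c < e := by
    rw [← ENNReal.ofReal_coe_nnreal] at hce
    exact (ENNReal.ofReal_lt_ofReal_iff_of_nonneg hc).1 hce
  have hex : ∃ ε : ℝ≥0, ∀ y' ∈ paretoFront μ z.1,
      Incomparable (fun i => μ z i + (ε : ℝ)) (μ (z.1, y')) := by
    by_contra! hno
    apply hz
    unfold gap
    refine iInf_eq_top.2 fun ε => iInf_eq_top.2 fun hε => ?_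
    obtain ⟨y', hy', hn⟩ := hno ε
    exact absurd (hε y' hy') hn
  obtain ⟨ε, hε⟩ := hex
  have hgε : gap μ z ≤ ε := iInf₂_le ε hε
  have heε : (e : ℝ) < ε := by exact_mod_cast heg.trans_le hgε
  -- The level `e`, strictly between `c` and the gap, would itself be admissible, contradicting the
  -- infimum. It is not dominated because `e > c`; it dominates no front point, since otherwise the
  -- larger admissible `ε` would too.
  refine heg.not_ge (iInf₂_le e fun y' hy' => ⟨fun hdom => ?_, fun hdom => ?_⟩)
  · obtain ⟨i, hi⟩ := h y' hy'
    have := hdom.1 i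
    simp only at this
    linarith
  · refine (hε y' hy').2 ⟨fun i => ?_, ⟨⟨0, hd⟩, ?_⟩⟩
    · have := hdom.1 i
      simp only at this ⊢
      linarith
    · have := hdom.1 ⟨0, hd⟩
      simp only at this ⊢
      linarith

/-- Two reward vectors differ by at most `D ≤ 1` in each objective, so `c = 1` serves against every
competitor. -/
lemma gap_le_one (hd : 0 < d) {D : X × Y → X × Y → ℝ} (hD : IsSimilarity D)
    {μ : X × Y → Fin d → ℝ} (hLip : ∀ (i : Fin d) (z z' : X × Y), |μ z i - μ z' i| ≤ D z z')
    {z : X × Y} (hz : gap μ z ≠ ⊤) : gap μ z ≤ 1 := by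
  rw [← ENNReal.ofReal_one]
  refine gap_le_of_forall_exists hd hz zero_le_one fun y' _ => ⟨⟨0, hd⟩, ?_⟩
  have h := (abs_le.1 ((hLip ⟨0, hd⟩ (z.1, y') z).trans (hD.le_one _ _))).2
  linarith

/-! ### Packing and zooming numbers -/

lemma card_le_packingNumber {D : X × Y → X × Y → ℝ} {r : ℝ} {S : Set (X × Y)} {ι : Type*}
    (hself : ∀ z, D z z = 0) (hr : 0 < r) (K : Finset ι) (c : ι → X × Y)
    (hS : ∀ k ∈ K, c k ∈ S)
    (hsep : ∀ k ∈ K, ∀ j ∈ K, k ≠ j → r ≤ D (c k) (c j)) :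
    (K.card : ℕ∞) ≤ packingNumber D r S := by
  -- Distinct indices have centers at distance at least `r > 0 = D z z`, so no two centers coincide.
  have hinj : Set.InjOn c (K : Set ι) := by
    intro k hk j hj hkj
    by_contra hne
    have h := hsep k hk j hj hne
    rw [hkj, hself] at h
    linarith
  have h1 : (c '' (K : Set ι)).encard = K.card := by
    rw [hinj.encard_image, Set.encard_coe_eq_coe_finsetCard]
  rw [← h1]
  refine le_iSup₂_of_le (c '' (K : Set ι)) ⟨?_, ?_⟩ le_rfl
  · rintro _ ⟨k, hk, rfl⟩
    exact hS k hk
  · rintro _ ⟨k, hk, rfl⟩ _ ⟨j, hj, rfl⟩ hne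
    exact hsep k hk j hj fun h => hne (h ▸ rfl)

lemma card_le_of_zoomingNumber_le {D : X × Y → X × Y → ℝ} {μ : X × Y → Fin d → ℝ} {r v : ℝ}
    {ι : Type*} (hself : ∀ z, D z z = 0) (hr : 0 < r) (hv : 0 ≤ v)
    (h : (zoomingNumber D μ r : ℝ≥0∞) ≤ ENNReal.ofReal v) (K : Finset ι) (c : ι → X × Y)
    (hS : ∀ k ∈ K, gap μ (c k) ≤ ENNReal.ofReal (12 * r))
    (hsep : ∀ k ∈ K, ∀ j ∈ K, k ≠ j → r ≤ D (c k) (c j)) :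
    (K.card : ℝ) ≤ v := by
  have h1 : (K.card : ℕ∞) ≤ zoomingNumber D μ r := card_le_packingNumber hself hr K c hS hsep
  have h2 : ((K.card : ℕ∞) : ℝ≥0∞) ≤ ENNReal.ofReal v := (ENat.toENNReal_le.2 h1).trans h
  rw [ENat.toENNReal_coe, ← ENNReal.ofReal_natCast] at h2
  exact (ENNReal.ofReal_le_ofReal_iff hv).1 h2

/-- An admissible constant of the zooming dimension is at least `1` when all gaps are finite. -/
lemma one_le_of_zoomingNumber_le [Nonempty (X × Y)] (hd : 0 < d) {D : X × Y → X × Y → ℝ}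
    (hD : IsSimilarity D) {μ : X × Y → Fin d → ℝ}
    (hLip : ∀ (i : Fin d) (z z' : X × Y), |μ z i - μ z' i| ≤ D z z')
    (hfin : ∀ z, gap μ z ≠ ⊤) {p a : ℝ} (hp : 0 < p)
    (h : ∀ r ∈ Set.Ioo (0 : ℝ) 1,
      (zoomingNumber D μ r : ℝ≥0∞) ≤ ENNReal.ofReal (p * r ^ (-a))) : 1 ≤ p := by
  -- A single point is a packing, and its gap is at most `1 ≤ 12 r`. The value `r = 1` is not
  -- covered by the hypothesis and is reached as a limit.
  have hbd : ∀ r ∈ Set.Ioo (1 / 2 : ℝ) 1, 1 ≤ p * r ^ (-a) := by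
    intro r hr
    have hr0 : 0 < r := by linarith [hr.1]
    have := card_le_of_zoomingNumber_le hD.self hr0 (by positivity) (h r ⟨hr0, hr.2⟩)
      ({()} : Finset Unit) (fun _ => Classical.arbitrary (X × Y))
      (fun _ _ => (gap_le_one hd hD hLip (hfin _)).trans
        (ENNReal.one_le_ofReal.2 (by linarith [hr.1])))
      (fun k _ j _ hkj => absurd (Subsingleton.elim k j) hkj)
    simpa using this
  have ht : Filter.Tendsto (fun r : ℝ => p * r ^ (-a)) (nhdsWithin 1 (Set.Iio 1))
      (nhds (p * (1 : ℝ) ^ (-a))) :=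
    ((Real.continuousAt_rpow_const 1 (-a) (Or.inl one_ne_zero)).const_mul p).tendsto.mono_left
      nhdsWithin_le_nhds
  rw [Real.one_rpow, mul_one] at ht
  refine ge_of_tendsto ht ?_
  filter_upwards [Ioo_mem_nhdsLT (show (1 / 2 : ℝ) < 1 by norm_num)] with r hr using hbd r hr

/-! ### Runs of the deterministic part -/

section Next

variable {T : ℕ} {δ : ℝ} {s : State X Y d} {z : X × Y} {ρ : Fin d → ℝ} {k j : ℕ}

lemma next_numBalls_of_le (h : s.unc T δ k ≤ (s.radius k : EReal)) :
    (s.next T δ z ρ k).numBalls = s.numBalls + 1 := by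
  simp [State.next, State.activate, State.record, h]

lemma next_numBalls_of_not_le (h : ¬ s.unc T δ k ≤ (s.radius k : EReal)) :
    (s.next T δ z ρ k).numBalls = s.numBalls := by
  simp [State.next, State.activate, State.record, h]

lemma numBalls_le_next : s.numBalls ≤ (s.next T δ z ρ k).numBalls := by
  by_cases h : s.unc T δ k ≤ (s.radius k : EReal)
  · rw [next_numBalls_of_le h]; omega
  · rw [next_numBalls_of_not_le h]

lemma next_numBalls_le : (s.next T δ z ρ k).numBalls ≤ s.numBalls + 1 := by
  by_cases h : s.unc T δ k ≤ (s.radius k : EReal)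
  · rw [next_numBalls_of_le h]
  · rw [next_numBalls_of_not_le h]; omega

lemma next_center_of_lt (hj : j < s.numBalls) : (s.next T δ z ρ k).center j = s.center j := by
  by_cases h : s.unc T δ k ≤ (s.radius k : EReal) <;>
    simp [State.next, State.activate, State.record, h, Function.update_of_ne hj.ne]

lemma next_radius_of_lt (hj : j < s.numBalls) : (s.next T δ z ρ k).radius j = s.radius j := by
  by_cases h : s.unc T δ k ≤ (s.radius k : EReal) <;>
    simp [State.next, State.activate, State.record, h, Function.update_of_ne hj.ne]

lemma next_center_numBalls (h : s.unc T δ k ≤ (s.radius k : EReal)) :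
    (s.next T δ z ρ k).center s.numBalls = z := by
  simp [State.next, State.activate, State.record, h]

lemma next_radius_numBalls (h : s.unc T δ k ≤ (s.radius k : EReal)) :
    (s.next T δ z ρ k).radius s.numBalls = s.radius k / 2 := by
  simp [State.next, State.activate, State.record, h]

lemma next_count_of_lt (hk : k < s.numBalls) (hj : j < s.numBalls) :
    (s.next T δ z ρ k).count j = if j = k then s.count k + 1 else s.count j := by
  by_cases h : s.unc T δ k ≤ (s.radius k : EReal) <;>
    simp [State.next, State.activate, State.record, h, Function.update_apply, hj.ne, hk.ne]

lemma next_count_numBalls (hk : k < s.numBalls) (h : s.unc T δ k ≤ (s.radius k : EReal)) :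
    (s.next T δ z ρ k).count s.numBalls = 0 := by
  simp [State.next, State.activate, State.record, h, Function.update_apply, hk.ne']

lemma next_est_of_lt (hk : k < s.numBalls) (hj : j < s.numBalls) (i : Fin d) :
    (s.next T δ z ρ k).est j i =
      if j = k then (s.est k i * s.count k + ρ i) / (s.count k + 1) else s.est j i := by
  by_cases h : s.unc T δ k ≤ (s.radius k : EReal) <;> by_cases hjk : j = k <;>
    simp [State.next, State.activate, State.record, h, hj.ne, hk.ne, hjk]

end Next

/-- The rounds before `t` in which ball `k` was chosen. -/
def rounds (b : ℕ → ℕ) (t k : ℕ) : Finset ℕ := (Finset.range t).filter fun s => b s = k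

lemma rounds_succ (b : ℕ → ℕ) (t k : ℕ) :
    rounds b (t + 1) k = if b t = k then insert t (rounds b t k) else rounds b t k := by
  rw [rounds, Finset.range_add_one, Finset.filter_insert, rounds]

lemma self_notMem_rounds (b : ℕ → ℕ) (t k : ℕ) : t ∉ rounds b t k := by simp [rounds]

lemma card_rounds_succ (b : ℕ → ℕ) (t k : ℕ) :
    (rounds b (t + 1) k).card = (rounds b t k).card + if b t = k then 1 else 0 := by
  rw [rounds_succ]
  split_ifs
  · rw [Finset.card_insert_of_notMem (self_notMem_rounds b t k)]
  · rfl

lemma sum_rounds_succ (b : ℕ → ℕ) (t k : ℕ) (f : ℕ → ℝ) :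
    ∑ s ∈ rounds b (t + 1) k, f s = (∑ s ∈ rounds b t k, f s) + if b t = k then f t else 0 := by
  rw [rounds_succ]
  split_ifs
  · rw [Finset.sum_insert (self_notMem_rounds b t k), add_comm]
  · rw [add_zero]

/-- The uncertainty of a ball with `n` samples is finite and at most `r`. -/
lemma unc_le_iff {T : ℕ} {δ : ℝ} {s : State X Y d} {k : ℕ} {r : ℝ} :
    s.unc T δ k ≤ (r : EReal) ↔ s.count k ≠ 0 ∧ √(2 * confA d T δ / s.count k) ≤ r := by
  unfold State.unc
  split_ifs with h
  · simp [h]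
  · simp [h]

/-- What holds before round `t` in a run in which the chosen ball is always a candidate. -/
structure Invariant (D : X × Y → X × Y → ℝ) (T : ℕ) (δ : ℝ) (μ : X × Y → Fin d → ℝ)
    (x : ℕ → X) (y : ℕ → Y) (κ : ℕ → Fin d → ℝ) (b : ℕ → ℕ) (t : ℕ) (s : State X Y d) :
    Prop where
  pos : 0 < s.numBalls
  numBalls_le : s.numBalls ≤ t + 1
  radius_zero : s.radius 0 = 1
  ball_lt : ∀ τ < t, b τ < s.numBalls
  count_eq : ∀ k < s.numBalls, s.count k = (rounds b t k).card
  -- Multiplying by the counter covers balls without samples and avoids a division.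
  est_eq : ∀ k < s.numBalls, ∀ i,
    s.est k i * s.count k = ∑ τ ∈ rounds b t k, (μ (x τ, y τ) i + κ τ i)
  dist_le : ∀ τ < t, D (x τ, y τ) (s.center (b τ)) ≤ s.radius (b τ)
  parent : ∀ k < s.numBalls, k ≠ 0 → ∃ j < s.numBalls, s.radius j = 2 * s.radius k ∧
    D (s.center k) (s.center j) ≤ s.radius j ∧ s.unc T δ j ≤ (s.radius j : EReal)
  radius_eq : ∀ k < s.numBalls, ∃ m : ℕ, s.radius k = (1 / 2) ^ m
  radius_le : ∀ k < s.numBalls, k ≠ 0 → s.radius k ≤ 1 / 2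
  separated : ∀ k < s.numBalls, ∀ j < s.numBalls, k ≠ j → s.radius k = s.radius j →
    s.radius k ≤ D (s.center k) (s.center j)

section Invariant

variable {D : X × Y → X × Y → ℝ} {T : ℕ} {δ : ℝ} {μ : X × Y → Fin d → ℝ}
    {x : ℕ → X} {y : ℕ → Y} {κ : ℕ → Fin d → ℝ} {b : ℕ → ℕ} {t : ℕ} {s : State X Y d}

lemma Invariant.init (D : X × Y → X × Y → ℝ) (T : ℕ) (δ : ℝ) (μ : X × Y → Fin d → ℝ)
    (x : ℕ → X) (y : ℕ → Y) (κ : ℕ → Fin d → ℝ) (b : ℕ → ℕ) (z₀ : X × Y) :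
    Invariant D T δ μ x y κ b 0 (State.init d z₀) where
  pos := by simp [State.init]
  numBalls_le := by simp [State.init]
  radius_zero := by simp [State.init]
  ball_lt := by simp
  count_eq := by simp [State.init, rounds]
  est_eq := by simp [State.init, rounds]
  dist_le := by simp
  parent := by
    intro k hk hk0
    simp only [State.init] at hk
    omega
  radius_eq := fun _ _ => ⟨0, by simp [State.init]⟩
  radius_le := by
    intro k hk hk0
    simp only [State.init] at hk
    omega
  separated := by
    intro k hk j hj hkj
    simp only [State.init] at hk hj
    omega

lemma Invariant.radius_pos (h : Invariant D T δ μ x y κ b t s) {k : ℕ} (hk : k < s.numBalls) :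
    0 < s.radius k := by
  obtain ⟨m, hm⟩ := h.radius_eq k hk
  rw [hm]
  positivity

lemma sqrt_div_antitone {A : ℝ} (hA : 0 ≤ A) {n m : ℕ} (hn : n ≠ 0) (hnm : n ≤ m) :
    √(2 * A / m) ≤ √(2 * A / n) := by
  have hn' : (0 : ℝ) < n := by exact_mod_cast Nat.pos_of_ne_zero hn
  have hnm' : (n : ℝ) ≤ m := by exact_mod_cast hnm
  gcongr

/-- The chosen ball contains the played pair in its domain, which gives `dist_le`, the parent of a
new ball and its separation. A parent stays certain because counters only grow. -/
lemma Invariant.next (hD : IsSimilarity D) (hA : 0 ≤ confA d T δ)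
    (h : Invariant D T δ μ x y κ b t s) (hb : b t ∈ s.candidates D T δ (x t) (y t)) :
    Invariant D T δ μ x y κ b (t + 1)
      (s.next T δ (x t, y t) (fun i => μ (x t, y t) i + κ t i) (b t)) := by
  have hbt : b t < s.numBalls := hb.1.1.1
  have hdom := hb.2
  set s' := s.next T δ (x t, y t) (fun i => μ (x t, y t) i + κ t i) (b t) with hs'
  have hle : s.numBalls ≤ s'.numBalls := numBalls_le_next
  have hnew : ∀ k < s'.numBalls, k < s.numBalls ∨
      (k = s.numBalls ∧ s.unc T δ (b t) ≤ (s.radius (b t) : EReal)) := by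
    intro k hk
    by_cases hu : s.unc T δ (b t) ≤ (s.radius (b t) : EReal)
    · have := next_numBalls_of_le (z := (x t, y t))
        (ρ := fun i => μ (x t, y t) i + κ t i) hu
      rw [← hs'] at this
      rcases Nat.lt_or_ge k s.numBalls with h1 | h1
      · exact Or.inl h1
      · exact Or.inr ⟨by omega, hu⟩
    · have := next_numBalls_of_not_le (z := (x t, y t))
        (ρ := fun i => μ (x t, y t) i + κ t i) hu
      rw [← hs'] at this
      exact Or.inl (by omega)
  have hunc : ∀ k < s.numBalls, s.unc T δ k ≤ (s.radius k : EReal) →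
      s'.unc T δ k ≤ (s'.radius k : EReal) := by
    intro k hk hu
    rw [unc_le_iff] at hu ⊢
    rw [hs', next_radius_of_lt hk, next_count_of_lt hbt hk]
    have hc : s.count k ≤ if k = b t then s.count (b t) + 1 else s.count k := by
      split_ifs with hkb
      · rw [hkb]; omega
      · exact le_rfl
    exact ⟨by have := hu.1; omega, (sqrt_div_antitone hA hu.1 hc).trans hu.2⟩
  -- The number of a newly activated ball exceeds all numbers chosen so far, this round included.
  have hempty : (rounds b (t + 1) s.numBalls) = ∅ := by
    refine Finset.filter_eq_empty_iff.2 fun τ hτ => ?_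
    rcases Nat.lt_succ_iff_lt_or_eq.1 (Finset.mem_range.1 hτ) with h1 | rfl
    · exact (h.ball_lt τ h1).ne
    · exact hbt.ne
  refine ⟨?_, ?_, ?_, ?_, ?_, ?_, ?_, ?_, ?_, ?_, ?_⟩
  · exact h.pos.trans_le hle
  · have := h.numBalls_le
    have := next_numBalls_le (T := T) (δ := δ) (s := s) (z := (x t, y t))
      (ρ := fun i => μ (x t, y t) i + κ t i) (k := b t)
    rw [← hs'] at this
    omega
  · rw [hs', next_radius_of_lt h.pos, h.radius_zero]
  · intro τ hτ
    rcases Nat.lt_succ_iff_lt_or_eq.1 hτ with h1 | rfl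
    · exact (h.ball_lt τ h1).trans_le hle
    · exact hbt.trans_le hle
  · intro k hk
    rcases hnew k hk with hk | ⟨rfl, hu⟩
    · rw [hs', next_count_of_lt hbt hk, card_rounds_succ, ← h.count_eq k hk]
      by_cases hkb : k = b t
      · simp [hkb]
      · simp [hkb, Ne.symm hkb]
    · rw [hs', next_count_numBalls hbt hu, hempty, Finset.card_empty]
  · intro k hk i
    rcases hnew k hk with hk | ⟨rfl, hu⟩
    · rw [hs', next_count_of_lt hbt hk, next_est_of_lt hbt hk, sum_rounds_succ,
        ← h.est_eq k hk i]
      by_cases hkb : k = b t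
      · have : ((s.count (b t) : ℝ) + 1) ≠ 0 := by positivity
        simp only [hkb, if_true]
        push_cast
        field_simp
      · simp [hkb, Ne.symm hkb]
    · rw [hs', next_count_numBalls hbt hu, hempty]
      simp
  · intro τ hτ
    rcases Nat.lt_succ_iff_lt_or_eq.1 hτ with h1 | rfl
    · rw [hs', next_center_of_lt (h.ball_lt τ h1), next_radius_of_lt (h.ball_lt τ h1)]
      exact h.dist_le τ h1
    · rw [hs', next_center_of_lt hbt, next_radius_of_lt hbt]
      exact hdom.1
  · intro k hk hk0
    rcases hnew k hk with hk | ⟨rfl, hu⟩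
    · obtain ⟨j, hj, h1, h2, h3⟩ := h.parent k hk hk0
      refine ⟨j, hj.trans_le hle, ?_, ?_, hunc j hj h3⟩
      · rw [hs', next_radius_of_lt hk, next_radius_of_lt hj, h1]
      · rw [hs', next_radius_of_lt hj, next_center_of_lt hj, next_center_of_lt hk]
        exact h2
    · refine ⟨b t, hbt.trans_le hle, ?_, ?_, hunc _ hbt hu⟩
      · rw [hs', next_radius_of_lt hbt, next_radius_numBalls hu]
        ring
      · rw [hs', next_center_numBalls hu, next_center_of_lt hbt, next_radius_of_lt hbt]
        exact hdom.1
  · intro k hk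
    rcases hnew k hk with hk | ⟨rfl, hu⟩
    · rw [hs', next_radius_of_lt hk]
      exact h.radius_eq k hk
    · obtain ⟨m, hm⟩ := h.radius_eq _ hbt
      refine ⟨m + 1, ?_⟩
      rw [hs', next_radius_numBalls hu, hm, pow_succ]
      ring
  · intro k hk hk0
    rcases hnew k hk with hk | ⟨rfl, hu⟩
    · rw [hs', next_radius_of_lt hk]
      exact h.radius_le k hk hk0
    · obtain ⟨m, hm⟩ := h.radius_eq _ hbt
      rw [hs', next_radius_numBalls hu, hm]
      have : ((1 : ℝ) / 2) ^ m ≤ 1 := pow_le_one₀ (by norm_num) (by norm_num)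
      linarith
  · have key : ∀ j < s.numBalls, s.unc T δ (b t) ≤ (s.radius (b t) : EReal) →
        s.radius j = s.radius (b t) / 2 → s.radius j ≤ D (x t, y t) (s.center j) := by
      intro j hj _ hr
      have hp := h.radius_pos hbt
      have := hdom.2 j hj (by linarith)
      simp only [State.ball, Set.mem_ofPred_eq, not_le] at this
      exact this.le
    intro k hk j hj hkj hr
    rcases hnew k hk with hk | ⟨rfl, hu⟩ <;> rcases hnew j hj with hj | ⟨rfl, hu'⟩
    · rw [hs', next_radius_of_lt hk, next_radius_of_lt hj] at hr
      rw [hs', next_radius_of_lt hk, next_center_of_lt hj, next_center_of_lt hk]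
      exact h.separated k hk j hj hkj hr
    · rw [hs', next_radius_of_lt hk, next_radius_numBalls hu'] at hr
      rw [hs', next_radius_of_lt hk, next_center_numBalls hu', next_center_of_lt hk, hD.symm]
      exact key k hk hu' hr
    · rw [hs', next_radius_of_lt hj, next_radius_numBalls hu] at hr
      rw [hs', next_radius_numBalls hu, next_center_numBalls hu, next_center_of_lt hj, hr]
      exact key j hj hu hr.symm
    · exact absurd rfl hkj

lemma invariant_stateAt (hD : IsSimilarity D) (hA : 0 ≤ confA d T δ) (z₀ : X × Y)
    (hb : ∀ t < T, b t ∈ (stateAt μ z₀ T δ x y κ b t).candidates D T δ (x t) (y t)) :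
    ∀ t ≤ T, Invariant D T δ μ x y κ b t (stateAt μ z₀ T δ x y κ b t) := by
  intro t
  induction t with
  | zero => exact fun _ => Invariant.init D T δ μ x y κ b z₀
  | succ t ih => exact fun ht => (ih (by omega)).next hD hA (hb t (by omega))

lemma numBalls_stateAt_mono (z₀ : X × Y) {t t' : ℕ} (h : t ≤ t') :
    (stateAt μ z₀ T δ x y κ b t).numBalls ≤ (stateAt μ z₀ T δ x y κ b t').numBalls :=
  monotone_nat_of_le_succ
    (f := fun t => (stateAt μ z₀ T δ x y κ b t).numBalls) (fun _ => numBalls_le_next) h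

lemma center_stateAt_eq (z₀ : X × Y) {t t' k : ℕ} (h : t ≤ t')
    (hk : k < (stateAt μ z₀ T δ x y κ b t).numBalls) :
    (stateAt μ z₀ T δ x y κ b t').center k = (stateAt μ z₀ T δ x y κ b t).center k := by
  induction t', h using Nat.le_induction with
  | base => rfl
  | succ n hn ih =>
    rw [← ih]
    exact next_center_of_lt (hk.trans_le (numBalls_stateAt_mono z₀ hn))

lemma radius_stateAt_eq (z₀ : X × Y) {t t' k : ℕ} (h : t ≤ t')
    (hk : k < (stateAt μ z₀ T δ x y κ b t).numBalls) :
    (stateAt μ z₀ T δ x y κ b t').radius k = (stateAt μ z₀ T δ x y κ b t).radius k := by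
  induction t', h using Nat.le_induction with
  | base => rfl
  | succ n hn ih =>
    rw [← ih]
    exact next_radius_of_lt (hk.trans_le (numBalls_stateAt_mono z₀ hn))

end Invariant

/-- The noise collected by each active ball obeys its confidence bound. -/
def NoiseBounded (T : ℕ) (δ : ℝ) (κ : ℕ → Fin d → ℝ) (b : ℕ → ℕ) (t : ℕ) : Prop :=
  ∀ k < T, ∀ i, |∑ τ ∈ rounds b t k, κ τ i| ≤ √(2 * confA d T δ * (rounds b t k).card)

/-! ### Optimism of the index and the gap of the played pair -/

section Index

variable {D : X × Y → X × Y → ℝ} {T : ℕ} {δ : ℝ} {μ : X × Y → Fin d → ℝ}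
    {x : ℕ → X} {y : ℕ → Y} {κ : ℕ → Fin d → ℝ} {b : ℕ → ℕ} {t : ℕ} {s : State X Y d}

/-- The error times the counter splits into bias and noise. Each sampled pair lies in the ball, so
the Lipschitz condition bounds the bias by the radius per sample; `NoiseBounded` controls the rest.
-/
lemma Invariant.abs_est_sub_le (h : Invariant D T δ μ x y κ b t s)
    (hLip : ∀ (i : Fin d) (z z' : X × Y), |μ z i - μ z' i| ≤ D z z') (ht : t < T)
    (hG : NoiseBounded T δ κ b t) {k : ℕ} (hk : k < s.numBalls) (hc : s.count k ≠ 0) (i : Fin d) :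
    |s.est k i - μ (s.center k) i| ≤ √(2 * confA d T δ / s.count k) + s.radius k := by
  have hn : (0 : ℝ) < s.count k := by exact_mod_cast Nat.pos_of_ne_zero hc
  have hcard := h.count_eq k hk
  have h1 : (s.est k i - μ (s.center k) i) * s.count k =
      ∑ τ ∈ rounds b t k, (μ (x τ, y τ) i - μ (s.center k) i) + ∑ τ ∈ rounds b t k, κ τ i := by
    rw [sub_mul, h.est_eq k hk i, Finset.sum_add_distrib, Finset.sum_sub_distrib,
      Finset.sum_const, nsmul_eq_mul, hcard]
    ring
  have h2 : |∑ τ ∈ rounds b t k, (μ (x τ, y τ) i - μ (s.center k) i)| ≤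
      s.count k * s.radius k := by
    refine (Finset.abs_sum_le_sum_abs _ _).trans ?_
    rw [hcard, ← nsmul_eq_mul]
    refine Finset.sum_le_card_nsmul _ _ _ fun τ hτ => ?_
    obtain ⟨hτt, rfl⟩ := Finset.mem_filter.1 hτ
    exact (hLip i _ _).trans (h.dist_le τ (Finset.mem_range.1 hτt))
  have h3 : √(2 * confA d T δ * s.count k) = √(2 * confA d T δ / s.count k) * s.count k := by
    rw [show 2 * confA d T δ * s.count k =
      2 * confA d T δ / s.count k * ((s.count k : ℝ) ^ 2) by field_simp,
      Real.sqrt_mul' _ (by positivity), Real.sqrt_sq hn.le]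
  -- At most one ball is activated per round, so `k < t + 1 ≤ T` and the noise bound applies to `k`.
  have h4 := hG k (by have := h.numBalls_le; omega) i
  rw [← hcard, h3] at h4
  refine le_of_mul_le_mul_right ?_ hn
  calc |s.est k i - μ (s.center k) i| * s.count k
      = |(s.est k i - μ (s.center k) i) * s.count k| := by rw [abs_mul, abs_of_pos hn]
    _ ≤ _ := by
        rw [h1]
        refine (abs_add_le _ _).trans ?_
        linarith

/-- Every active ball certifies an upper bound at every point, so the minimum in the index is still
one. Without samples the bound is `⊤`. -/
lemma Invariant.le_preIndex_add (h : Invariant D T δ μ x y κ b t s)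
    (hLip : ∀ (i : Fin d) (z z' : X × Y), |μ z i - μ z' i| ≤ D z z') (ht : t < T)
    (hG : NoiseBounded T δ κ b t) {j : ℕ} (hj : j < s.numBalls) (z : X × Y) (i : Fin d) :
    ((μ z i : ℝ) : EReal) ≤ s.preIndex T δ j i + (D (s.center j) z : EReal) := by
  unfold State.preIndex State.unc
  split_ifs with hc
  · rw [EReal.coe_add_top, EReal.top_add_coe, EReal.top_add_coe]
    exact le_top
  · have h1 := (abs_le.1 (h.abs_est_sub_le hLip ht hG hj hc i)).1
    have h2 := (abs_le.1 (hLip i (s.center j) z)).1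
    norm_cast
    linarith

lemma Invariant.le_index (h : Invariant D T δ μ x y κ b t s)
    (hLip : ∀ (i : Fin d) (z z' : X × Y), |μ z i - μ z' i| ≤ D z z') (ht : t < T)
    (hG : NoiseBounded T δ κ b t) {k : ℕ} {z : X × Y} (hz : z ∈ s.ball D k)
    (i : Fin d) : ((μ z i : ℝ) : EReal) ≤ s.index D T δ k i := by
  have h1 : ((μ (s.center k) i : ℝ) : EReal) ≤ (Finset.range s.numBalls).inf
      (fun j => s.preIndex T δ j i + (D (s.center j) (s.center k) : EReal)) :=
    Finset.le_inf fun j hj => h.le_preIndex_add hLip ht hG (Finset.mem_range.1 hj) _ i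
  refine le_trans ?_ (add_le_add_right h1 _)
  have h2 := (abs_le.1 (hLip i z (s.center k))).2
  have h3 : D z (s.center k) ≤ s.radius k := hz
  norm_cast
  linarith

/-- The minimum is at most its term `j`. There the estimation error and the added uncertainty and
radius give `2 (u + r)`, at most `4 r`. -/
lemma Invariant.index_le (h : Invariant D T δ μ x y κ b t s)
    (hLip : ∀ (i : Fin d) (z z' : X × Y), |μ z i - μ z' i| ≤ D z z') (ht : t < T)
    (hG : NoiseBounded T δ κ b t) {j : ℕ} (hj : j < s.numBalls)
    (hu : s.unc T δ j ≤ (s.radius j : EReal)) (k : ℕ) (i : Fin d) :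
    s.index D T δ k i ≤ ((μ (s.center j) i + 4 * s.radius j + D (s.center j) (s.center k) +
      s.radius k : ℝ) : EReal) := by
  have h1 : (Finset.range s.numBalls).inf
      (fun j => s.preIndex T δ j i + (D (s.center j) (s.center k) : EReal)) ≤
      s.preIndex T δ j i + (D (s.center j) (s.center k) : EReal) :=
    Finset.inf_le (Finset.mem_range.2 hj)
  refine (add_le_add_right h1 _).trans ?_
  obtain ⟨hc, hu⟩ := unc_le_iff.1 hu
  have h2 := (abs_le.1 (h.abs_est_sub_le hLip ht hG hj hc i)).2
  unfold State.preIndex State.unc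
  rw [if_neg hc]
  norm_cast
  linarith

/-- The first ball has radius `1 ≥ D` and covers everything, so some active ball contains `z`; one
of least radius has `z` in its domain. -/
lemma Invariant.exists_mem_dom (h : Invariant D T δ μ x y κ b t s) (hD : IsSimilarity D)
    (z : X × Y) : ∃ j < s.numBalls, z ∈ s.dom D j := by
  classical
  obtain ⟨j, hj, hmin⟩ := Finset.exists_min_image
    ((Finset.range s.numBalls).filter fun j => z ∈ s.ball D j) s.radius
    ⟨0, Finset.mem_filter.2 ⟨Finset.mem_range.2 h.pos, by
      have := hD.le_one z (s.center 0)
      rw [← h.radius_zero] at this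
      exact this⟩⟩
  obtain ⟨hj, hzj⟩ := Finset.mem_filter.1 hj
  refine ⟨j, Finset.mem_range.1 hj, hzj, fun k hk hkj hzk => ?_⟩
  exact hkj.not_ge (hmin k (Finset.mem_filter.2 ⟨Finset.mem_range.2 hk, hzk⟩))

/-- For a competitor `y'`, take a relevant ball covering it. In an objective where that ball's index
does not exceed the chosen one, optimism gives `μ (x₀, y') i ≤ μ (x₀, y₀) i + c`. -/
lemma Invariant.gap_le_of_index_le (h : Invariant D T δ μ x y κ b t s) (hd : 0 < d)
    (hD : IsSimilarity D) (hLip : ∀ (i : Fin d) (z z' : X × Y), |μ z i - μ z' i| ≤ D z z')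
    (ht : t < T) (hG : NoiseBounded T δ κ b t) {k : ℕ} {x₀ : X} {y₀ : Y}
    (hk : k ∈ s.candidates D T δ x₀ y₀) (hfin : gap μ (x₀, y₀) ≠ ⊤) {c : ℝ} (hc : 0 ≤ c)
    (hidx : ∀ i, s.index D T δ k i ≤ ((μ (x₀, y₀) i + c : ℝ) : EReal)) :
    gap μ (x₀, y₀) ≤ ENNReal.ofReal c := by
  refine gap_le_of_forall_exists hd hfin hc fun y' _ => ?_
  obtain ⟨j, hj, hdom⟩ := h.exists_mem_dom hD (x₀, y')
  have : Nonempty (Fin d) := ⟨⟨0, hd⟩⟩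
  obtain ⟨i, hi⟩ := exists_le_of_not_dominated (hk.1.2 j ⟨hj, y', hdom⟩)
  refine ⟨i, EReal.coe_le_coe_iff.1 ?_⟩
  exact (h.le_index hLip ht hG hdom.1 i).trans (hi.trans (hidx i))

/-- The gap of the pair played when ball `k` with small uncertainty is chosen. -/
lemma Invariant.gap_le_six_mul (h : Invariant D T δ μ x y κ b t s) (hd : 0 < d)
    (hD : IsSimilarity D) (hLip : ∀ (i : Fin d) (z z' : X × Y), |μ z i - μ z' i| ≤ D z z')
    (ht : t < T) (hG : NoiseBounded T δ κ b t) {k : ℕ} {x₀ : X} {y₀ : Y}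
    (hk : k ∈ s.candidates D T δ x₀ y₀) (hfin : gap μ (x₀, y₀) ≠ ⊤)
    (hu : s.unc T δ k ≤ (s.radius k : EReal)) :
    gap μ (x₀, y₀) ≤ ENNReal.ofReal (6 * s.radius k) := by
  have hkn := hk.1.1.1
  have hr := h.radius_pos hkn
  -- Take `j = k` in `index_le`: `4r + r`, and one more `r` from the center to the played pair.
  refine h.gap_le_of_index_le hd hD hLip ht hG hk hfin (by positivity) fun i => ?_
  refine (h.index_le hLip ht hG hkn hu k i).trans (EReal.coe_le_coe_iff.2 ?_)
  have h1 : D (x₀, y₀) (s.center k) ≤ s.radius k := hk.2.1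
  have h2 := (abs_le.1 (hLip i (x₀, y₀) (s.center k))).1
  have h3 := hD.self (s.center k)
  linarith

/-- The gap of the pair played when ball `k` is chosen. -/
lemma Invariant.gap_le_fourteen_mul (h : Invariant D T δ μ x y κ b t s) (hd : 0 < d)
    (hD : IsSimilarity D) (hLip : ∀ (i : Fin d) (z z' : X × Y), |μ z i - μ z' i| ≤ D z z')
    (ht : t < T) (hG : NoiseBounded T δ κ b t) {k : ℕ} {x₀ : X} {y₀ : Y}
    (hk : k ∈ s.candidates D T δ x₀ y₀) (hfin : gap μ (x₀, y₀) ≠ ⊤) :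
    gap μ (x₀, y₀) ≤ ENNReal.ofReal (14 * s.radius k) := by
  have hkn := hk.1.1.1
  have hr := h.radius_pos hkn
  by_cases hk0 : k = 0
  · rw [hk0, h.radius_zero]
    exact (gap_le_one hd hD hLip hfin).trans (ENNReal.one_le_ofReal.2 (by norm_num))
  -- The parent has radius `2r`: the index costs `8r + 2r + r`, and passing from the parent's center
  -- to the played pair costs `2r + r`, in total `14 r`.
  obtain ⟨j, hj, hrj, hDj, hu⟩ := h.parent k hkn hk0
  refine h.gap_le_of_index_le hd hD hLip ht hG hk hfin (by positivity) fun i => ?_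
  refine (h.index_le hLip ht hG hj hu k i).trans (EReal.coe_le_coe_iff.2 ?_)
  have h1 : D (x₀, y₀) (s.center k) ≤ s.radius k := hk.2.1
  have h2 := (abs_le.1 (hLip i (x₀, y₀) (s.center k))).1
  have h3 := (abs_le.1 (hLip i (s.center k) (s.center j))).1
  have h4 := hD.symm (s.center k) (s.center j)
  linarith

end Index

/-! ### Charging each round to a ball -/

section Charge

variable {D : X × Y → X × Y → ℝ} {T : ℕ} {δ : ℝ} {μ : X × Y → Fin d → ℝ}
    {x : ℕ → X} {y : ℕ → Y} {κ : ℕ → Fin d → ℝ} {b : ℕ → ℕ} {z₀ : X × Y}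

/-- The centers of all balls but the first have small gap. -/
lemma gap_center_le (hd : 0 < d) (hD : IsSimilarity D)
    (hLip : ∀ (i : Fin d) (z z' : X × Y), |μ z i - μ z' i| ≤ D z z')
    (hA : 0 ≤ confA d T δ)
    (hb : ∀ t < T, b t ∈ (stateAt μ z₀ T δ x y κ b t).candidates D T δ (x t) (y t))
    (hG : ∀ t < T, NoiseBounded T δ κ b t) (hfin : ∀ z, gap μ z ≠ ⊤) :
    ∀ t ≤ T, ∀ k < (stateAt μ z₀ T δ x y κ b t).numBalls, k ≠ 0 →
      gap μ ((stateAt μ z₀ T δ x y κ b t).center k) ≤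
        ENNReal.ofReal (12 * (stateAt μ z₀ T δ x y κ b t).radius k) := by
  intro t
  induction t with
  | zero =>
    intro _ k hk hk0
    simp only [stateAt, State.init] at hk
    omega
  | succ t ih =>
    intro ht k hk hk0
    rcases Nat.lt_or_ge k (stateAt μ z₀ T δ x y κ b t).numBalls with hlt | hge
    · rw [center_stateAt_eq z₀ t.le_succ hlt, radius_stateAt_eq z₀ t.le_succ hlt]
      exact ih (by omega) k hlt hk0
    · have hu : (stateAt μ z₀ T δ x y κ b t).unc T δ (b t) ≤
          ((stateAt μ z₀ T δ x y κ b t).radius (b t) : EReal) := by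
        by_contra hu
        rw [stateAt, next_numBalls_of_not_le hu] at hk
        omega
      have hk' : k = (stateAt μ z₀ T δ x y κ b t).numBalls := by
        rw [stateAt, next_numBalls_of_le hu] at hk
        omega
      rw [hk', stateAt, next_center_numBalls hu, next_radius_numBalls hu]
      -- The new radius is half the chosen one, so `6 r = 12 (r / 2)`: this is the `12` in
      -- `zoomingNumber`.
      refine ((invariant_stateAt hD hA z₀ hb t (by omega)).gap_le_six_mul hd hD hLip (by omega)
        (hG t (by omega)) (hb t (by omega)) (hfin _) hu).trans (ENNReal.ofReal_le_ofReal ?_)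
      linarith

open Classical in
/-- The ball to which the gap of round `t` is charged: the ball activated in this round if there is
one, otherwise the chosen ball. -/
noncomputable def chargedBall (μ : X × Y → Fin d → ℝ) (z₀ : X × Y) (T : ℕ) (δ : ℝ) (x : ℕ → X) (y : ℕ → Y)
    (κ : ℕ → Fin d → ℝ) (b : ℕ → ℕ) (t : ℕ) : ℕ :=
  if (stateAt μ z₀ T δ x y κ b t).unc T δ (b t) ≤
    ((stateAt μ z₀ T δ x y κ b t).radius (b t) : EReal)
  then (stateAt μ z₀ T δ x y κ b t).numBalls else b t

lemma chargedBall_lt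
    (hb : ∀ t < T, b t ∈ (stateAt μ z₀ T δ x y κ b t).candidates D T δ (x t) (y t))
    {t : ℕ} (ht : t < T) :
    chargedBall μ z₀ T δ x y κ b t < (stateAt μ z₀ T δ x y κ b T).numBalls := by
  refine lt_of_lt_of_le ?_ (numBalls_stateAt_mono z₀ (Nat.succ_le_of_lt ht))
  unfold chargedBall
  split_ifs with hu
  · rw [Nat.succ_eq_add_one, stateAt, next_numBalls_of_le hu]
    omega
  · exact (hb t ht).1.1.1.trans_le (numBalls_stateAt_mono z₀ t.le_succ)

lemma gap_le_chargedBall (hd : 0 < d) (hD : IsSimilarity D)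
    (hLip : ∀ (i : Fin d) (z z' : X × Y), |μ z i - μ z' i| ≤ D z z')
    (hA : 0 ≤ confA d T δ)
    (hb : ∀ t < T, b t ∈ (stateAt μ z₀ T δ x y κ b t).candidates D T δ (x t) (y t))
    (hG : ∀ t < T, NoiseBounded T δ κ b t) (hfin : ∀ z, gap μ z ≠ ⊤) {t : ℕ} (ht : t < T) :
    gap μ (x t, y t) ≤ ENNReal.ofReal (14 *
      (stateAt μ z₀ T δ x y κ b T).radius (chargedBall μ z₀ T δ x y κ b t)) := by
  have hinv := invariant_stateAt hD hA z₀ hb t ht.le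
  have hbt := (hb t ht).1.1.1
  have hr := hinv.radius_pos hbt
  unfold chargedBall
  split_ifs with hu
  · rw [radius_stateAt_eq z₀ (Nat.succ_le_of_lt ht)
      (by rw [Nat.succ_eq_add_one, stateAt, next_numBalls_of_le hu]; omega),
      Nat.succ_eq_add_one, stateAt, next_radius_numBalls hu]
    refine (hinv.gap_le_six_mul hd hD hLip ht (hG t ht) (hb t ht) (hfin _) hu).trans
      (ENNReal.ofReal_le_ofReal ?_)
    linarith
  · rw [radius_stateAt_eq z₀ ht.le hbt]
    exact hinv.gap_le_fourteen_mul hd hD hLip ht (hG t ht) (hb t ht) (hfin _)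

/-- A ball is activated at most once. Before the last round in which it is chosen while uncertain,
it has fewer than `2A/r²` samples; that round adds one. -/
lemma card_chargedBall_le (hD : IsSimilarity D) (hA : 0 ≤ confA d T δ)
    (hb : ∀ t < T, b t ∈ (stateAt μ z₀ T δ x y κ b t).candidates D T δ (x t) (y t)) (k : ℕ) :
    (((Finset.range T).filter fun t => chargedBall μ z₀ T δ x y κ b t = k).card : ℝ) ≤
      2 + 2 * confA d T δ / (stateAt μ z₀ T δ x y κ b T).radius k ^ 2 := by
  classical
  set U : ℕ → Prop := fun t => (stateAt μ z₀ T δ x y κ b t).unc T δ (b t) ≤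
    ((stateAt μ z₀ T δ x y κ b t).radius (b t) : EReal) with hU
  set F := (Finset.range T).filter fun t => chargedBall μ z₀ T δ x y κ b t = k
  have h1 : (F.filter U).card ≤ 1 := by
    refine Finset.card_le_one.2 fun t ht t' ht' => ?_
    have key : ∀ t t', U t → t < t' → (stateAt μ z₀ T δ x y κ b t).numBalls <
        (stateAt μ z₀ T δ x y κ b t').numBalls := by
      intro t t' hu hlt
      refine lt_of_lt_of_le ?_ (numBalls_stateAt_mono z₀ (Nat.succ_le_of_lt hlt))
      rw [Nat.succ_eq_add_one, stateAt, next_numBalls_of_le hu]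
      omega
    have hval : ∀ t ∈ F.filter U, (stateAt μ z₀ T δ x y κ b t).numBalls = k := by
      intro t ht
      obtain ⟨ht, hu⟩ := Finset.mem_filter.1 ht
      have := (Finset.mem_filter.1 ht).2
      rwa [chargedBall, if_pos hu] at this
    have e1 := hval t ht
    have e2 := hval t' ht'
    rcases lt_trichotomy t t' with h | h | h
    · have := key t t' (Finset.mem_filter.1 ht).2 h
      omega
    · exact h
    · have := key t' t (Finset.mem_filter.1 ht').2 h
      omega
  have h2 : ((F.filter fun t => ¬ U t).card : ℝ) ≤
      1 + 2 * confA d T δ / (stateAt μ z₀ T δ x y κ b T).radius k ^ 2 := by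
    have hval : ∀ t ∈ F.filter (fun t => ¬ U t), t < T ∧ b t = k ∧ ¬ U t := by
      intro t ht
      obtain ⟨ht, hu⟩ := Finset.mem_filter.1 ht
      obtain ⟨htT, h⟩ := Finset.mem_filter.1 ht
      rw [chargedBall, if_neg hu] at h
      exact ⟨Finset.mem_range.1 htT, h, hu⟩
    rcases (F.filter fun t => ¬ U t).eq_empty_or_nonempty with he | hne
    · rw [he, Finset.card_empty]
      push_cast
      positivity
    · set m := (F.filter fun t => ¬ U t).max' hne
      obtain ⟨hmT, hmk, hmU⟩ := hval m (Finset.max'_mem _ hne)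
      have hinv := invariant_stateAt hD hA z₀ hb m hmT.le
      have hkn : k < (stateAt μ z₀ T δ x y κ b m).numBalls := hmk ▸ (hb m hmT).1.1.1
      have hsub : (F.filter fun t => ¬ U t) ⊆ insert m (rounds b m k) := by
        intro t ht
        rcases (Finset.le_max' _ t ht).lt_or_eq with hlt | heq
        · exact Finset.mem_insert_of_mem
            (Finset.mem_filter.2 ⟨Finset.mem_range.2 hlt, (hval t ht).2.1⟩)
        · exact heq ▸ Finset.mem_insert_self _ _
      have hcard : (F.filter fun t => ¬ U t).card ≤ (rounds b m k).card + 1 :=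
        (Finset.card_le_card hsub).trans (Finset.card_insert_le _ _)
      have hr := hinv.radius_pos hkn
      have hcnt : ((rounds b m k).card : ℝ) ≤
          2 * confA d T δ / (stateAt μ z₀ T δ x y κ b T).radius k ^ 2 := by
        rw [radius_stateAt_eq z₀ hmT.le hkn]
        simp only [hU, hmk, unc_le_iff, hinv.count_eq k hkn, not_and, not_le] at hmU
        by_cases h0 : (rounds b m k).card = 0
        · rw [h0]
          push_cast
          positivity
        · have h3 := (Real.lt_sqrt hr.le).1 (hmU h0)
          have hn : (0 : ℝ) < (rounds b m k).card := by exact_mod_cast Nat.pos_of_ne_zero h0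
          rw [le_div_iff₀ (by positivity)]
          rw [lt_div_iff₀ hn] at h3
          linarith
      have hcard' : ((F.filter fun t => ¬ U t).card : ℝ) ≤ (rounds b m k).card + 1 := by
        exact_mod_cast hcard
      linarith
  have h3 : ((F.filter U).card : ℝ) ≤ 1 := by exact_mod_cast h1
  rw [← Finset.card_filter_add_card_filter_not U]
  push_cast
  linarith

end Charge

/-! ### Summation over the scales -/

lemma sum_range_pow_le_two_mul_pow {q : ℝ} (hq : 2 ≤ q) (M : ℕ) :
    ∑ n ∈ Finset.range (M + 1), q ^ n ≤ 2 * q ^ M := by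
  induction M with
  | zero => simp
  | succ M ih =>
    rw [Finset.sum_range_succ, pow_succ]
    have : 0 ≤ q ^ M := by positivity
    nlinarith

/-- Grouped by scale, the sum is at most `p ∑ qⁿ` with `q = 2^(1+a) ≥ 2`, hence at most twice its
last term. The smallest radius is at least `r₀`, which bounds that term. -/
lemma sum_inv_radius_le {K : Finset ℕ} {r : ℕ → ℝ} {m : ℕ → ℕ} {r₀ a p : ℝ}
    (hr : ∀ k ∈ K, r k = (1 / 2) ^ m k) (hr₀ : 0 < r₀) (hle : ∀ k ∈ K, r₀ ≤ r k) (ha : 0 < a)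
    (hp : 0 ≤ p)
    (hcard : ∀ n, ((K.filter fun k => m k = n).card : ℝ) ≤ p * ((1 / 2 : ℝ) ^ n) ^ (-a)) :
    ∑ k ∈ K, (r k)⁻¹ ≤ 2 * p * r₀ ^ (-(1 + a)) := by
  rcases K.eq_empty_or_nonempty with rfl | hK
  · rw [Finset.sum_empty]
    positivity
  obtain ⟨k₀, hk₀, hmax⟩ := Finset.exists_max_image K m hK
  set q : ℝ := (1 / 2 : ℝ) ^ (-(1 + a)) with hq
  have hqpow : ∀ n : ℕ, ((1 / 2 : ℝ) ^ n) ^ (-(1 + a)) = q ^ n := fun n => by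
    rw [hq, ← Real.rpow_natCast, ← Real.rpow_natCast, ← Real.rpow_mul (by norm_num),
      ← Real.rpow_mul (by norm_num), mul_comm]
  have hq2 : 2 ≤ q := by
    have : (1 / 2 : ℝ) ^ (-1 : ℝ) ≤ q :=
      Real.rpow_le_rpow_of_exponent_ge (by norm_num) (by norm_num) (by linarith)
    rw [Real.rpow_neg_one] at this
    linarith
  calc ∑ k ∈ K, (r k)⁻¹
      = ∑ n ∈ Finset.range (m k₀ + 1), ∑ k ∈ K with m k = n, (r k)⁻¹ :=
        (Finset.sum_fiberwise_of_maps_to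
          (fun k hk => Finset.mem_range.2 (Nat.lt_succ_of_le (hmax k hk))) _).symm
    _ ≤ ∑ n ∈ Finset.range (m k₀ + 1), p * q ^ n := by
        refine Finset.sum_le_sum fun n _ => ?_
        have h1 : ∀ k ∈ K.filter (fun k => m k = n), (r k)⁻¹ = ((1 / 2 : ℝ) ^ n)⁻¹ := by
          intro k hk
          obtain ⟨hkK, rfl⟩ := Finset.mem_filter.1 hk
          rw [hr k hkK]
        rw [Finset.sum_congr rfl h1, Finset.sum_const, nsmul_eq_mul, ← hqpow, neg_add,
          Real.rpow_add (by positivity), Real.rpow_neg_one, mul_left_comm, mul_comm]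
        exact mul_le_mul_of_nonneg_left (hcard n) (by positivity)
    _ ≤ p * (2 * q ^ m k₀) := by
        rw [← Finset.mul_sum]
        exact mul_le_mul_of_nonneg_left (sum_range_pow_le_two_mul_pow hq2 _) hp
    _ ≤ 2 * p * r₀ ^ (-(1 + a)) := by
        have h2 : q ^ m k₀ ≤ r₀ ^ (-(1 + a)) := by
          rw [← hqpow, ← hr k₀ hk₀]
          exact Real.rpow_le_rpow_of_nonpos hr₀ (hle k₀ hk₀) (by linarith)
        nlinarith

section Regret

variable {D : X × Y → X × Y → ℝ} {T : ℕ} {δ : ℝ} {μ : X × Y → Fin d → ℝ}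
    {x : ℕ → X} {y : ℕ → Y} {κ : ℕ → Fin d → ℝ} {b : ℕ → ℕ} {z₀ : X × Y}

/-- The regret on the event that all noise sums obey their confidence bounds. -/
lemma regret_le_of_noiseBounded (hd : 0 < d) (hD : IsSimilarity D)
    (hLip : ∀ (i : Fin d) (z z' : X × Y), |μ z i - μ z' i| ≤ D z z')
    {L : ℝ} (hL : 1 ≤ L) (hA : confA d T δ = 2 * L - 1)
    (hb : ∀ t < T, b t ∈ (stateAt μ z₀ T δ x y κ b t).candidates D T δ (x t) (y t))
    (hG : ∀ t < T, NoiseBounded T δ κ b t) (hfin : ∀ z, gap μ z ≠ ⊤)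
    {p a r₀ : ℝ} (hp : 0 < p) (ha : 0 < a) (hr₀ : 0 < r₀)
    (hzoom : ∀ r ∈ Set.Ioo (0 : ℝ) 1,
      (zoomingNumber D μ r : ℝ≥0∞) ≤ ENNReal.ofReal (p * r ^ (-a))) :
    regret μ T x y ≤ ENNReal.ofReal (14 * r₀ * T + 112 * p * L * r₀ ^ (-(1 + a))) := by
  have hA0 : 0 ≤ confA d T δ := by rw [hA]; linarith
  have hinv := invariant_stateAt hD hA0 z₀ hb T le_rfl
  set s := stateAt μ z₀ T δ x y κ b T with hs
  set φ := chargedBall μ z₀ T δ x y κ b with hφ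
  have hφlt : ∀ t ∈ Finset.range T, φ t ∈ Finset.range s.numBalls := fun t ht =>
    Finset.mem_range.2 (chargedBall_lt hb (Finset.mem_range.1 ht))
  -- Charges to balls of radius below `r₀` are absorbed in `14 r₀` per round; `g` keeps the others.
  set g : ℕ → ℝ := fun k => if r₀ ≤ s.radius k then 14 * s.radius k else 0 with hg
  have hg0 : ∀ k, 0 ≤ g k := by
    intro k
    simp only [hg]
    split_ifs with h
    · linarith
    · exact le_rfl
  have hgap : ∀ t ∈ Finset.range T, gap μ (x t, y t) ≤ ENNReal.ofReal (14 * r₀ + g (φ t)) := by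
    intro t ht
    refine (gap_le_chargedBall hd hD hLip hA0 hb hG hfin (Finset.mem_range.1 ht)).trans
      (ENNReal.ofReal_le_ofReal ?_)
    simp only [hg]
    split_ifs with h
    · linarith
    · linarith [not_le.1 h]
  unfold regret
  refine (Finset.sum_le_sum hgap).trans ?_
  rw [← ENNReal.ofReal_sum_of_nonneg fun t _ => by have := hg0 (φ t); positivity]
  refine ENNReal.ofReal_le_ofReal ?_
  rw [Finset.sum_add_distrib, Finset.sum_const, Finset.card_range, nsmul_eq_mul]
  set K := (Finset.range s.numBalls).filter fun k => r₀ ≤ s.radius k with hK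
  have hp1 : 1 ≤ p :=
    have : Nonempty (X × Y) := ⟨z₀⟩
    one_le_of_zoomingNumber_le hd hD hLip hfin hp hzoom
  choose! m hm using hinv.radius_eq
  have hsum : ∑ k ∈ K, (s.radius k)⁻¹ ≤ 2 * p * r₀ ^ (-(1 + a)) := by
    refine sum_inv_radius_le (m := m)
      (fun k hk => hm k (Finset.mem_range.1 (Finset.mem_filter.1 hk).1)) hr₀
      (fun k hk => (Finset.mem_filter.1 hk).2) ha hp.le fun n => ?_
    have hmem : ∀ k ∈ K.filter (fun k => m k = n), k < s.numBalls ∧ s.radius k = (1 / 2) ^ n := by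
      intro k hk
      obtain ⟨hkK, rfl⟩ := Finset.mem_filter.1 hk
      have hk' := Finset.mem_range.1 (Finset.mem_filter.1 hkK).1
      exact ⟨hk', hm k hk'⟩
    -- At scale `0` the radius `1` is outside the range of the zooming bound. Only the first ball
    -- lives there, and `1 ≤ p` accounts for it.
    rcases Nat.eq_zero_or_pos n with rfl | hn
    · have h1 : (K.filter fun k => m k = 0).card ≤ 1 := by
        have h0 : ∀ k ∈ K.filter (fun k => m k = 0), k = 0 := by
          intro k hk
          obtain ⟨hk, hr⟩ := hmem k hk
          by_contra hk0
          have := hinv.radius_le k hk hk0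
          rw [hr] at this
          norm_num at this
        exact Finset.card_le_one.2 fun k hk j hj => (h0 k hk).trans (h0 j hj).symm
      have h2 : ((K.filter fun k => m k = 0).card : ℝ) ≤ 1 := by exact_mod_cast h1
      simpa using h2.trans hp1
    · have hr1 : (1 / 2 : ℝ) ^ n < 1 := pow_lt_one₀ (by norm_num) (by norm_num) hn.ne'
      have hr0 : (0 : ℝ) < (1 / 2 : ℝ) ^ n := by positivity
      refine card_le_of_zoomingNumber_le hD.self hr0 (by positivity) (hzoom _ ⟨hr0, hr1⟩) _
        s.center (fun k hk => ?_) (fun k hk j hj hkj => ?_)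
      · obtain ⟨hk, hr⟩ := hmem k hk
        have hk0 : k ≠ 0 := by
          rintro rfl
          rw [hinv.radius_zero] at hr
          linarith
        have := gap_center_le hd hD hLip hA0 hb hG hfin T le_rfl k hk hk0
        rwa [← hs, hr] at this
      · obtain ⟨hk, hr⟩ := hmem k hk
        obtain ⟨hj, hr'⟩ := hmem j hj
        rw [← hr]
        exact hinv.separated k hk j hj hkj (hr.trans hr'.symm)
  have hfib : ∑ t ∈ Finset.range T, g (φ t) ≤ ∑ k ∈ K, 56 * L * (s.radius k)⁻¹ := by
    rw [← Finset.sum_fiberwise_of_maps_to hφlt, hK, Finset.sum_filter]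
    refine Finset.sum_le_sum fun k hk => ?_
    have h1 : ∀ t ∈ (Finset.range T).filter (fun t => φ t = k), g (φ t) = g k := fun t ht => by
      rw [(Finset.mem_filter.1 ht).2]
    rw [Finset.sum_congr rfl h1, Finset.sum_const, nsmul_eq_mul]
    simp only [hg]
    split_ifs with hrk
    · have hr := hinv.radius_pos (Finset.mem_range.1 hk)
      have hr1 : s.radius k ≤ 1 := by
        rw [hm k (Finset.mem_range.1 hk)]
        exact pow_le_one₀ (by norm_num) (by norm_num)
      have h2 := card_chargedBall_le hD hA0 hb k
      rw [← hs] at h2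
      calc _ ≤ (2 + 2 * confA d T δ / s.radius k ^ 2) * (14 * s.radius k) :=
            mul_le_mul_of_nonneg_right h2 (by positivity)
        _ = 28 * (s.radius k + (2 * L - 1) * (s.radius k)⁻¹) := by
            rw [hA]
            field_simp
            ring
        _ ≤ 56 * L * (s.radius k)⁻¹ := by
            have : 1 ≤ (s.radius k)⁻¹ := (one_le_inv₀ hr).2 hr1
            linarith
    · rw [mul_zero]
  rw [← Finset.mul_sum] at hfib
  have h4 := mul_le_mul_of_nonneg_left hsum (show (0 : ℝ) ≤ 56 * L by linarith)
  linarith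

end Regret

/-! ### Concentration of the noise -/

/-- A factor whose integral over each set of a sub-σ-algebra is at most the measure of the set does
not increase the integral of a function measurable with respect to that σ-algebra. -/
lemma lintegral_mul_le_of_forall_setLIntegral_le {Ω : Type*} {m m0 : MeasurableSpace Ω}
    {P : Measure Ω} (hm : m ≤ m0) {f g : Ω → ℝ≥0∞} (hf : Measurable[m] f) (hg : Measurable g)
    (h : ∀ s, MeasurableSet[m] s → ∫⁻ ω in s, g ω ∂P ≤ P s) :
    ∫⁻ ω, f ω * g ω ∂P ≤ ∫⁻ ω, f ω ∂P := by
  -- The hypothesis compares the measures with densities `g` and `1` on the sub-σ-algebra, which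
  -- suffices since `f` is measurable there.
  have hle : (P.withDensity g).trim hm ≤ P.trim hm := by
    refine Measure.le_iff.2 fun s hs => ?_
    rw [trim_measurableSet_eq hm hs, trim_measurableSet_eq hm hs, withDensity_apply _ (hm s hs)]
    exact h s hs
  calc ∫⁻ ω, f ω * g ω ∂P = ∫⁻ ω, f ω ∂(P.withDensity g) := by
        rw [lintegral_withDensity_eq_lintegral_mul _ hg (hf.mono hm le_rfl)]
        simp only [Pi.mul_apply, mul_comm]
    _ = ∫⁻ ω, f ω ∂((P.withDensity g).trim hm) := (lintegral_trim hm hf).symm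
    _ ≤ ∫⁻ ω, f ω ∂(P.trim hm) := lintegral_mono' hle le_rfl
    _ = ∫⁻ ω, f ω ∂P := lintegral_trim hm hf

/-- The conditional sub-Gaussian bound is integrated over `s`, and the factor `exp (-l²/2)`
normalizes it to `P s`. -/
lemma setLIntegral_exp_sub_le {Ω : Type*} {m m0 : MeasurableSpace Ω}
    {P : Measure Ω} [IsProbabilityMeasure P] (hm : m ≤ m0) {Z : Ω → ℝ} {l : ℝ}
    (hint : Integrable (fun ω => Real.exp (l * Z ω)) P)
    (hsub : ∀ᵐ ω ∂P, (P[fun ω' => Real.exp (l * Z ω') | m]) ω ≤ Real.exp (l ^ 2 / 2))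
    {s : Set Ω} (hs : MeasurableSet[m] s) :
    ∫⁻ ω in s, ENNReal.ofReal (Real.exp (l * Z ω - l ^ 2 / 2)) ∂P ≤ P s := by
  have heq : ∀ ω, Real.exp (l * Z ω - l ^ 2 / 2) =
      Real.exp (l * Z ω) * Real.exp (-(l ^ 2 / 2)) := fun ω => by
    rw [← Real.exp_add, sub_eq_add_neg]
  simp only [heq]
  rw [← ofReal_integral_eq_lintegral_ofReal (hint.integrableOn.mul_const _)
    (ae_of_all _ fun ω => by positivity), integral_mul_const, ← setIntegral_condExp hm hint hs]
  have h1 : ∫ ω in s, (P[fun ω' => Real.exp (l * Z ω') | m]) ω ∂P ≤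
      ∫ _ in s, Real.exp (l ^ 2 / 2) ∂P :=
    setIntegral_mono_ae integrable_condExp.integrableOn (integrable_const _).integrableOn hsub
  rw [setIntegral_const, smul_eq_mul] at h1
  refine ENNReal.ofReal_le_of_le_toReal ?_
  calc _ ≤ P.real s * Real.exp (l ^ 2 / 2) * Real.exp (-(l ^ 2 / 2)) :=
        mul_le_mul_of_nonneg_right h1 (Real.exp_pos _).le
    _ = P.real s := by rw [mul_assoc, ← Real.exp_add, add_neg_cancel, Real.exp_zero, mul_one]
    _ = (P s).toReal := rfl

/-! ### Exponential supermartingales of the noise sums -/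

section Filtration

variable {Ω : Type*} [MeasurableSpace Y] {y : ℕ → Ω → Y} {κ : ℕ → Ω → Fin d → ℝ} {b : ℕ → Ω → ℕ}

lemma measurable_noise_preNoise {τ t : ℕ} (h : τ < t) : Measurable[preNoise y κ b t] (κ τ) := by
  refine (comap_measurable (κ τ)).mono (le_trans ?_ (le_sup_left.trans le_sup_left)) le_rfl
  exact le_trans (le_sup_right.trans le_sup_left)
    (le_iSup (fun s : Fin t => (MeasurableSpace.comap (y s) inferInstance ⊔
      MeasurableSpace.comap (κ s) inferInstance ⊔ MeasurableSpace.comap (b s) inferInstance))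
      ⟨τ, h⟩)

lemma measurable_ball_preNoise {τ t : ℕ} (h : τ ≤ t) : Measurable[preNoise y κ b t] (b τ) := by
  rcases h.lt_or_eq with h | rfl
  · refine (comap_measurable (b τ)).mono (le_trans ?_ (le_sup_left.trans le_sup_left)) le_rfl
    exact le_trans le_sup_right
      (le_iSup (fun s : Fin t => (MeasurableSpace.comap (y s) inferInstance ⊔
        MeasurableSpace.comap (κ s) inferInstance ⊔ MeasurableSpace.comap (b s) inferInstance))
        ⟨τ, h⟩)
  · exact (comap_measurable (b τ)).mono le_sup_right le_rfl

/-- The exponential supermartingale of the noise collected by ball `k` in objective `i`. -/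
noncomputable def expNoise (κ : ℕ → Ω → Fin d → ℝ) (b : ℕ → Ω → ℕ) (k : ℕ) (i : Fin d) (l : ℝ) (t : ℕ)
    (ω : Ω) : ℝ≥0∞ :=
  ENNReal.ofReal (Real.exp (∑ τ ∈ rounds (fun s => b s ω) t k, (l * κ τ ω i - l ^ 2 / 2)))

lemma measurable_expNoise (k : ℕ) (i : Fin d) (l : ℝ) (t : ℕ) :
    Measurable[preNoise y κ b t] (expNoise κ b k i l t) := by
  refine ENNReal.measurable_ofReal.comp (Real.measurable_exp.comp ?_)
  simp only [rounds, Finset.sum_filter]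
  refine Finset.measurable_sum _ fun τ hτ => ?_
  have hτ' := Finset.mem_range.1 hτ
  refine Measurable.ite (measurable_ball_preNoise hτ'.le (measurableSet_singleton k)) ?_
    measurable_const
  exact (((measurable_pi_apply i).comp (measurable_noise_preNoise hτ')).const_mul l).sub_const _

/-- Where a noise sum violates its confidence bound, an exponential supermartingale is large. -/
lemma exp_le_expNoise_of_lt_abs {k : ℕ} {i : Fin d} {t : ℕ} {ω : Ω} {A : ℝ} (hA : 0 < A)
    (h : √(2 * A * (rounds (fun s => b s ω) t k).card) <
      |∑ τ ∈ rounds (fun s => b s ω) t k, κ τ ω i|) :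
    ∃ σ : Bool, ENNReal.ofReal (Real.exp A) ≤ expNoise κ b k i
      ((if σ then 1 else -1) * √(2 * A / (rounds (fun s => b s ω) t k).card)) t ω := by
  set R := rounds (fun s => b s ω) t k with hR
  set S := ∑ τ ∈ R, κ τ ω i with hS
  have hn0 : R.card ≠ 0 := by
    intro h0
    rw [hS, Finset.card_eq_zero.1 h0] at h
    simp at h
  have hn : (0 : ℝ) < R.card := by exact_mod_cast Nat.pos_of_ne_zero hn0
  -- This value maximizes the exponent at the threshold: `w |S| - n w²/2 > 2A - A = A`. The Boolean
  -- is the sign of `S`.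
  set w := √(2 * A / R.card) with hw
  have hw2 : w ^ 2 = 2 * A / R.card := Real.sq_sqrt (by positivity)
  have hwS : w * √(2 * A * R.card) = 2 * A := by
    rw [hw, ← Real.sqrt_mul (by positivity), show 2 * A / R.card * (2 * A * R.card) = (2 * A) ^ 2 by
      field_simp, Real.sqrt_sq (by positivity)]
  have hwpos : 0 < w := Real.sqrt_pos.2 (by positivity)
  have h1 : 2 * A < w * |S| := hwS ▸ mul_lt_mul_of_pos_left h hwpos
  have hval : ∀ c : ℝ, c ^ 2 = 1 → ∑ τ ∈ R, (c * w * κ τ ω i - (c * w) ^ 2 / 2) =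
      w * (c * S) - A := by
    intro c hc
    rw [Finset.sum_sub_distrib, ← Finset.mul_sum, Finset.sum_const, nsmul_eq_mul, mul_pow, hc,
      hw2, ← hS]
    field_simp
  unfold expNoise
  rcases abs_choice S with hs | hs
  · refine ⟨true, ENNReal.ofReal_le_ofReal (Real.exp_le_exp.2 ?_)⟩
    rw [← hR, hval _ (by norm_num)]
    rw [hs] at h1
    simp only [if_true, one_mul]
    linarith
  · refine ⟨false, ENNReal.ofReal_le_ofReal (Real.exp_le_exp.2 ?_)⟩
    rw [← hR, hval _ (by norm_num)]
    rw [hs] at h1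
    simp only [Bool.false_eq_true, if_false, neg_mul, one_mul]
    linarith

lemma card_rounds_le (b : ℕ → ℕ) (t k : ℕ) : (rounds b t k).card ≤ t :=
  (Finset.card_filter_le _ _).trans (Finset.card_range t).le

end Filtration

section Run

variable {Ω : Type*} [MeasurableSpace Y] [MeasurableSpace Ω] {D : X × Y → X × Y → ℝ}
    {μ : X × Y → Fin d → ℝ} {z₀ : X × Y} {T : ℕ} {δ : ℝ} {x : ℕ → X} {ν : Measure Y}
    {P : Measure Ω} {y : ℕ → Ω → Y} {κ : ℕ → Ω → Fin d → ℝ} {b : ℕ → Ω → ℕ}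

lemma IsRun.preArm_le (h : IsRun D μ z₀ T δ x ν P y κ b) (t : ℕ) :
    preArm y κ b t ≤ ‹MeasurableSpace Ω› :=
  iSup_le fun s => sup_le (sup_le (h.measurable_arm s).comap_le (h.measurable_noise s).comap_le)
    (h.measurable_ball s).comap_le

lemma IsRun.preBall_le (h : IsRun D μ z₀ T δ x ν P y κ b) (t : ℕ) :
    preBall y κ b t ≤ ‹MeasurableSpace Ω› :=
  sup_le (h.preArm_le t) (h.measurable_arm t).comap_le

lemma IsRun.preNoise_le (h : IsRun D μ z₀ T δ x ν P y κ b) (t : ℕ) :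
    preNoise y κ b t ≤ ‹MeasurableSpace Ω› :=
  sup_le (h.preBall_le t) (h.measurable_ball t).comap_le

/-- The choice of ball is known before the noise. Where `k` is chosen the new factor has conditional
mean at most `1`; elsewhere it equals `1`. -/
lemma IsRun.lintegral_expNoise_le_one [IsProbabilityMeasure P]
    (h : IsRun D μ z₀ T δ x ν P y κ b) (k : ℕ) (i : Fin d) (l : ℝ) :
    ∀ t ≤ T, ∫⁻ ω, expNoise κ b k i l t ω ∂P ≤ 1 := by
  intro t
  induction t with
  | zero =>
    intro _
    simp [expNoise, rounds]
  | succ t ih =>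
    classical
    intro ht
    have hm := h.preNoise_le t
    have hbk : MeasurableSet[preNoise y κ b t] (b t ⁻¹' {k}) :=
      measurable_ball_preNoise le_rfl (measurableSet_singleton k)
    set e : Ω → ℝ≥0∞ := fun ω => ENNReal.ofReal (Real.exp (l * κ t ω i - l ^ 2 / 2)) with he
    have hemeas : Measurable e := ENNReal.measurable_ofReal.comp (Real.measurable_exp.comp
      ((((measurable_pi_apply i).comp (h.measurable_noise t)).const_mul l).sub_const _))
    have hfac : ∀ ω, expNoise κ b k i l (t + 1) ω =
        expNoise κ b k i l t ω * (b t ⁻¹' {k}).piecewise e 1 ω := by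
      intro ω
      unfold expNoise
      rw [sum_rounds_succ]
      by_cases hb : b t ω = k
      · rw [if_pos hb, Set.piecewise_eq_of_mem _ _ _ (show ω ∈ b t ⁻¹' {k} from hb), Real.exp_add,
          ENNReal.ofReal_mul (Real.exp_pos _).le]
      · rw [if_neg hb, Set.piecewise_eq_of_notMem _ _ _ (show ω ∉ b t ⁻¹' {k} from hb), add_zero, Pi.one_apply,
          mul_one]
    simp only [hfac]
    refine (lintegral_mul_le_of_forall_setLIntegral_le hm (measurable_expNoise k i l t)
      (hemeas.piecewise (hm _ hbk) measurable_one) fun s hs => ?_).trans (ih (by omega))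
    rw [← lintegral_inter_add_sdiff _ s (hm _ hbk), ← measure_inter_add_sdiff s (hm _ hbk)]
    refine add_le_add ?_ ?_
    · rw [setLIntegral_congr_fun ((hm _ hs).inter (hm _ hbk))
        (fun ω hω => Set.piecewise_eq_of_mem (b t ⁻¹' {k}) e 1 hω.2)]
      exact setLIntegral_exp_sub_le hm (h.noise_integrable t (by omega) i l)
        (h.noise_subGaussian t (by omega) i l) (hs.inter hbk)
    · rw [setLIntegral_congr_fun ((hm _ hs).diff (hm _ hbk))
        (fun ω hω => Set.piecewise_eq_of_notMem (b t ⁻¹' {k}) e 1 hω.2)]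
      simp

lemma IsRun.measure_exp_le_expNoise_le [IsProbabilityMeasure P]
    (h : IsRun D μ z₀ T δ x ν P y κ b) (k : ℕ) (i : Fin d) (l A : ℝ) {t : ℕ} (ht : t ≤ T) :
    P {ω | ENNReal.ofReal (Real.exp A) ≤ expNoise κ b k i l t ω} ≤
      ENNReal.ofReal (Real.exp (-A)) := by
  have h1 := mul_meas_ge_le_lintegral (μ := P)
    ((measurable_expNoise (y := y) k i l t).mono (h.preNoise_le t) le_rfl)
    (ENNReal.ofReal (Real.exp A))
  have h2 := h1.trans (h.lintegral_expNoise_le_one k i l t ht)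
  rw [Real.exp_neg, ENNReal.ofReal_inv_of_pos (Real.exp_pos _), ← one_div]
  rw [ENNReal.le_div_iff_mul_le (Or.inl (by simp [Real.exp_pos])) (Or.inl ENNReal.ofReal_ne_top),
    mul_comm]
  exact h2

/-- The noise sums violate their confidence bounds with small probability. -/
lemma IsRun.measure_not_noiseBounded_le [IsProbabilityMeasure P]
    (h : IsRun D μ z₀ T δ x ν P y κ b) (hA : 0 < confA d T δ) :
    P {ω | ¬ ∀ t < T, NoiseBounded T δ (fun s => κ s ω) (fun s => b s ω) t} ≤
      ENNReal.ofReal (2 * d * (T : ℝ) ^ 3 * Real.exp (-confA d T δ)) := by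
  -- The coordinates are round, ball, sample count, objective and sign. The parameter `l` depends on
  -- the random count, so the union bound also runs over its values, all at most `t < T`.
  set J : Finset (ℕ × ℕ × ℕ × Fin d × Bool) :=
    Finset.range T ×ˢ Finset.range T ×ˢ Finset.range T ×ˢ Finset.univ with hJ
  set E : ℕ × ℕ × ℕ × Fin d × Bool → Set Ω := fun j =>
    {ω | ENNReal.ofReal (Real.exp (confA d T δ)) ≤ expNoise κ b j.2.1 j.2.2.2.1
      ((if j.2.2.2.2 then 1 else -1) * √(2 * confA d T δ / j.2.2.1)) j.1 ω} with hE
  have hsub : {ω | ¬ ∀ t < T, NoiseBounded T δ (fun s => κ s ω) (fun s => b s ω) t} ⊆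
      ⋃ j ∈ J, E j := by
    intro ω hω
    simp only [NoiseBounded, Set.mem_ofPred_eq, not_forall, not_le] at hω
    obtain ⟨t, ht, k, hk, i, hlt⟩ := hω
    obtain ⟨σ, hσ⟩ := exp_le_expNoise_of_lt_abs hA hlt
    have hc := card_rounds_le (fun s => b s ω) t k
    refine Set.mem_biUnion (x := (t, k, (rounds (fun s => b s ω) t k).card, i, σ)) ?_ hσ
    simp only [hJ, Finset.coe_product, Set.mem_prod, Finset.mem_coe, Finset.mem_range,
      Finset.mem_univ, and_true]
    exact ⟨ht, hk, by omega⟩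
  refine (measure_mono hsub).trans ((measure_biUnion_finset_le J E).trans ?_)
  have hle : ∀ j ∈ J, P (E j) ≤ ENNReal.ofReal (Real.exp (-confA d T δ)) := fun j hj =>
    h.measure_exp_le_expNoise_le _ _ _ _ (Finset.mem_range.1 (Finset.mem_product.1 hj).1).le
  refine (Finset.sum_le_card_nsmul J _ _ hle).trans_eq ?_
  have hcard : (J.card : ℝ) = 2 * d * (T : ℝ) ^ 3 := by
    simp only [hJ, Finset.card_product, Finset.card_range, Finset.card_univ, Fintype.card_prod,
      Fintype.card_fin, Fintype.card_bool]
    push_cast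
    ring
  rw [nsmul_eq_mul, ← hcard, ENNReal.ofReal_mul (by positivity), ENNReal.ofReal_natCast]

/-- The chosen ball is almost surely a candidate. -/
lemma IsRun.ae_mem_candidates [IsProbabilityMeasure P] (h : IsRun D μ z₀ T δ x ν P y κ b) :
    ∀ᵐ ω ∂P, ∀ t < T, b t ω ∈
      (randomState μ z₀ T δ x y κ b t ω).candidates D T δ (x t) (y t ω) := by
  refine ae_all_iff.2 fun t => ?_
  by_cases ht : t < T
  swap
  · exact ae_of_all _ fun ω h' => absurd h' ht
  have hm := h.preBall_le t
  have hne : ∀ k : ℕ, ∀ᵐ ω ∂P, b t ω = k →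
      (P[fun ω' => if b t ω' = k then (1 : ℝ) else 0 | preBall y κ b t]) ω ≠ 0 := by
    intro k
    set f : Ω → ℝ := fun ω' => if b t ω' = k then (1 : ℝ) else 0 with hf
    have hbk : MeasurableSet {ω | b t ω = k} := h.measurable_ball t (measurableSet_singleton k)
    have hfi : Integrable f P := by
      have : f = Set.indicator {ω | b t ω = k} (fun _ => (1 : ℝ)) := by
        ext ω
        simp [hf, Set.indicator_apply]
      rw [this]
      exact (integrable_const _).indicator hbk
    -- Where the conditional probability of choosing `k` vanishes, `k` is almost surely not chosen.
    -- By `ball_uniform` it vanishes for every non-candidate.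
    set Z : Set Ω := {ω | (P[f | preBall y κ b t]) ω = 0} with hZ
    have hZm : MeasurableSet[preBall y κ b t] Z :=
      stronglyMeasurable_condExp.measurable (measurableSet_singleton 0)
    have h0 : ∫ ω in Z, f ω ∂P = 0 := by
      rw [← setIntegral_condExp hm hfi hZm]
      exact setIntegral_eq_zero_of_forall_eq_zero fun ω hω => hω
    have hnn : 0 ≤ f := fun ω => by
      simp only [hf, Pi.zero_apply]
      split_ifs <;> norm_num
    have h1 := (integral_eq_zero_iff_of_nonneg hnn hfi.integrableOn).1 h0
    have h2 := (ae_restrict_iff' (hm _ hZm)).1 h1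
    filter_upwards [h2] with ω hω hbω hz
    have := hω hz
    simp [hf, hbω] at this
  filter_upwards [ae_all_iff.2 hne, ae_all_iff.2 (h.ball_uniform t ht)] with ω h1 h2 _
  have h3 := h1 (b t ω) rfl
  rw [h2 (b t ω)] at h3
  by_contra hc
  exact h3 (if_neg hc)

end Run

/-! ### The expected regret -/

/-! ### Failure probability and balancing of the scale -/

section Constants

variable {T : ℕ}

lemma one_le_logArg (hd : 0 < d) (hT : 0 < T) :
    1 ≤ 2 * √2 * (d : ℝ) * (T : ℝ) ^ (5 / 2 : ℝ) := by
  have h1 : (1 : ℝ) ≤ d := by exact_mod_cast hd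
  have h2 : (1 : ℝ) ≤ (T : ℝ) ^ (5 / 2 : ℝ) :=
    Real.one_le_rpow (by exact_mod_cast hT) (by norm_num)
  have h3 : (1 : ℝ) ≤ √2 := Real.one_le_sqrt.2 (by norm_num)
  have h4 : (1 : ℝ) ≤ √2 * d := one_le_mul_of_one_le_of_one_le h3 h1
  have h5 := one_le_mul_of_one_le_of_one_le h4 h2
  linarith

lemma confA_one_div (hT : 0 < T) :
    confA d T (1 / (T : ℝ)) = 1 + 2 * Real.log (2 * √2 * d * (T : ℝ) ^ (5 / 2 : ℝ)) := by
  have hT' : (0 : ℝ) < T := by exact_mod_cast hT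
  have : (T : ℝ) ^ (5 / 2 : ℝ) = (T : ℝ) ^ (3 / 2 : ℝ) * T := by
    rw [show (5 / 2 : ℝ) = 3 / 2 + 1 by norm_num, Real.rpow_add hT', Real.rpow_one]
  rw [confA, this, div_div_eq_mul_div, div_one, mul_assoc]

/-- With `Q` the argument of the logarithm, `exp (-A) ≤ Q⁻² = 1 / (8 d² T⁵)`. -/
lemma failure_le (hd : 0 < d) (hT : 0 < T) :
    2 * d * (T : ℝ) ^ 3 * Real.exp (-confA d T (1 / (T : ℝ))) ≤ 1 / T := by
  have hT1 : (1 : ℝ) ≤ T := by exact_mod_cast hT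
  have hd1 : (1 : ℝ) ≤ d := by exact_mod_cast hd
  set Q := 2 * √2 * (d : ℝ) * (T : ℝ) ^ (5 / 2 : ℝ) with hQ
  have hQ1 : 1 ≤ Q := one_le_logArg hd hT
  have hQ2 : Q ^ 2 = 8 * d ^ 2 * T ^ 5 := by
    rw [hQ, mul_pow, mul_pow, mul_pow, Real.sq_sqrt (by norm_num), ← Real.rpow_natCast
      ((T : ℝ) ^ (5 / 2 : ℝ)), ← Real.rpow_mul (by positivity)]
    norm_num
  have hexp : Real.exp (-confA d T (1 / (T : ℝ))) ≤ 1 / Q ^ 2 := by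
    rw [confA_one_div hT, ← hQ, Real.exp_neg, ← one_div]
    refine one_div_le_one_div_of_le (by positivity) ?_
    rw [Real.exp_add, two_mul, Real.exp_add, Real.exp_log (by linarith), ← sq]
    exact le_mul_of_one_le_left (by positivity) (Real.one_le_exp zero_le_one)
  refine (mul_le_mul_of_nonneg_left hexp (by positivity)).trans ?_
  rw [hQ2, mul_one_div, div_le_div_iff₀ (by positivity) (by positivity)]
  have h1 : (T : ℝ) ^ 4 ≤ T ^ 5 := pow_le_pow_right₀ hT1 (by norm_num)
  have h2 : (d : ℝ) ≤ d ^ 2 := by nlinarith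
  calc 2 * d * (T : ℝ) ^ 3 * T = 2 * d * T ^ 4 := by ring
    _ ≤ 2 * (d : ℝ) ^ 2 * T ^ 5 := by gcongr
    _ ≤ 1 * (8 * d ^ 2 * T ^ 5) := by
        have : 0 ≤ (d : ℝ) ^ 2 * T ^ 5 := by positivity
        linarith

/-- The scale `r₀ = T^(-1/(2+a))` solves `r₀ T = r₀^(-(1+a))`. -/
lemma scale_balance (hT : 0 < T) {a K : ℝ} (ha : 0 < a) :
    14 * (T : ℝ) ^ (-(1 / (2 + a))) * T + K * ((T : ℝ) ^ (-(1 / (2 + a)))) ^ (-(1 + a)) =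
      (14 + K) * (T : ℝ) ^ ((1 + a) / (2 + a)) := by
  have hT' : (0 : ℝ) < T := by exact_mod_cast hT
  have h2 : 2 + a ≠ 0 := by positivity
  have h1 : (T : ℝ) ^ (-(1 / (2 + a))) * T = (T : ℝ) ^ ((1 + a) / (2 + a)) := by
    nth_rewrite 2 [← Real.rpow_one (T : ℝ)]
    rw [← Real.rpow_add hT']
    congr 1
    field_simp
    ring
  rw [← Real.rpow_mul hT'.le, mul_assoc, h1, show -(1 / (2 + a)) * -(1 + a) = (1 + a) / (2 + a) by
    field_simp]
  ring

end Constants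

lemma regret_le_mul_maxGap (μ : X × Y → Fin d → ℝ) (T : ℕ) (x : ℕ → X) (y : ℕ → Y) :
    regret μ T x y ≤ T * maxGap μ := by
  refine (Finset.sum_le_card_nsmul _ _ (maxGap μ) fun t _ => le_iSup (gap μ) _).trans_eq ?_
  rw [Finset.card_range, nsmul_eq_mul]

lemma regret_le_card (hd : 0 < d) {D : X × Y → X × Y → ℝ} (hD : IsSimilarity D)
    {μ : X × Y → Fin d → ℝ} (hLip : ∀ (i : Fin d) (z z' : X × Y), |μ z i - μ z' i| ≤ D z z')
    (hfin : ∀ z, gap μ z ≠ ⊤) (T : ℕ) (x : ℕ → X) (y : ℕ → Y) :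
    regret μ T x y ≤ T := by
  refine (Finset.sum_le_card_nsmul _ _ 1 fun t _ => gap_le_one hd hD hLip (hfin _)).trans_eq ?_
  rw [Finset.card_range, nsmul_eq_mul, mul_one]

/-- A bound of the regret on the event that the noise sums obey their confidence bounds yields a
bound of the expected regret. -/
lemma IsRun.lintegral_regret_le {Ω : Type*} [MeasurableSpace Y] [MeasurableSpace Ω]
    {D : X × Y → X × Y → ℝ} {μ : X × Y → Fin d → ℝ} {z₀ : X × Y} {T : ℕ} {x : ℕ → X}
    {ν : Measure Y} {P : Measure Ω} [IsProbabilityMeasure P] {y : ℕ → Ω → Y}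
    {κ : ℕ → Ω → Fin d → ℝ} {b : ℕ → Ω → ℕ}
    (h : IsRun D μ z₀ T (1 / (T : ℝ)) x ν P y κ b) (hd : 0 < d) (hT : 0 < T) {B : ℝ≥0∞}
    (hB : ∀ (y' : ℕ → Y) (κ' : ℕ → Fin d → ℝ) (b' : ℕ → ℕ),
      (∀ t < T, b' t ∈
        (stateAt μ z₀ T (1 / (T : ℝ)) x y' κ' b' t).candidates D T (1 / (T : ℝ)) (x t) (y' t)) →
      (∀ t < T, NoiseBounded T (1 / (T : ℝ)) κ' b' t) → regret μ T x y' ≤ B) :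
    ∫⁻ ω, regret μ T x (fun t => y t ω) ∂P ≤ B + maxGap μ := by
  have hA : 0 < confA d T (1 / (T : ℝ)) := by
    rw [confA_one_div hT]
    have := Real.log_nonneg (one_le_logArg hd hT)
    linarith
  set G : Set Ω := {ω | ¬ ∀ t < T,
    NoiseBounded T (1 / (T : ℝ)) (fun s => κ s ω) (fun s => b s ω) t} with hG
  have hPG : P G ≤ ENNReal.ofReal (1 / T) :=
    (h.measure_not_noiseBounded_le hA).trans (ENNReal.ofReal_le_ofReal (failure_le hd hT))
  calc ∫⁻ ω, regret μ T x (fun t => y t ω) ∂P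
      ≤ ∫⁻ ω, (B + G.indicator (fun _ => T * maxGap μ) ω) ∂P := by
        refine lintegral_mono_ae ?_
        filter_upwards [h.ae_mem_candidates] with ω hω
        by_cases hωG : ω ∈ G
        · rw [Set.indicator_of_mem hωG]
          exact (regret_le_mul_maxGap μ T x _).trans le_add_self
        · exact (hB _ (fun s => κ s ω) (fun s => b s ω) hω (not_not.1 hωG)).trans le_self_add
    _ = B + ∫⁻ ω, G.indicator (fun _ => T * maxGap μ) ω ∂P := by
        rw [lintegral_add_left measurable_const, lintegral_const, measure_univ, mul_one]
    _ ≤ B + T * maxGap μ * P G := by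
        gcongr
        -- This inequality requires no measurability of `G`.
        exact lintegral_indicator_const_le _ _
    _ ≤ B + maxGap μ := by
        gcongr
        calc T * maxGap μ * P G ≤ T * maxGap μ * ENNReal.ofReal (1 / T) := by gcongr
          _ = maxGap μ * (T * ENNReal.ofReal (1 / T)) := by ring
          _ = maxGap μ := by
              have hT' : (T : ℝ) ≠ 0 := by exact_mod_cast hT.ne'
              rw [← ENNReal.ofReal_natCast, ← ENNReal.ofReal_mul (by positivity),
                mul_one_div_cancel hT', ENNReal.ofReal_one, mul_one]

/-- A bound that holds for the exponents of all admissible `a` holds for the exponent of the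
zooming dimension. -/
lemma le_of_forall_admissible {D : X × Y → X × Y → ℝ} {μ : X × Y → Fin d → ℝ} {p C : ℝ}
    {I M : ℝ≥0∞} {T : ℕ} (hT : 0 < T) (hC : 0 ≤ C) (hdim : zoomingDim D μ p ≠ ⊤)
    (h : ∀ a : ℝ, 0 < a → (∀ r ∈ Set.Ioo (0 : ℝ) 1,
      (zoomingNumber D μ r : ℝ≥0∞) ≤ ENNReal.ofReal (p * r ^ (-a))) →
      I ≤ ENNReal.ofReal (C * (T : ℝ) ^ ((1 + a) / (2 + a))) + M) :
    I ≤ ENNReal.ofReal (C * (T : ℝ) ^ regretExponent (zoomingDim D μ p)) + M := by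
  have hT1 : (1 : ℝ) ≤ T := by exact_mod_cast hT
  set w := (zoomingDim D μ p).toReal with hw
  have hw0 : 0 ≤ w := ENNReal.toReal_nonneg
  rw [regretExponent, if_neg hdim, ← hw]
  -- The infimum defining the dimension need not be attained. Some admissible `a` lies below `w + η`
  -- for each `η > 0`, and `η` tends to `0`.
  have hcont : ContinuousAt (fun η : ℝ => ENNReal.ofReal
      (C * (T : ℝ) ^ ((1 + (w + η)) / (2 + (w + η)))) + M) 0 := by
    refine (ENNReal.continuous_ofReal.continuousAt.comp ?_).add continuousAt_const
    refine continuousAt_const.mul (ContinuousAt.rpow continuousAt_const ?_ (Or.inl (by positivity)))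
    exact ContinuousAt.div (by fun_prop) (by fun_prop) (by positivity)
  have ht := hcont.tendsto.mono_left (nhdsWithin_le_nhds (s := Set.Ioi 0))
  rw [add_zero] at ht
  refine ge_of_tendsto ht ?_
  filter_upwards [self_mem_nhdsWithin] with η hη
  have hη' : 0 < η := hη
  have hlt : zoomingDim D μ p < ENNReal.ofReal (w + η) := by
    rw [← ENNReal.ofReal_toReal hdim, ← hw]
    exact (ENNReal.ofReal_lt_ofReal_iff (by positivity)).2 (by linarith)
  unfold zoomingDim at hlt
  simp only [iInf_lt_iff] at hlt
  obtain ⟨a, ⟨ha, hadm⟩, halt⟩ := hlt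
  have haη : a < w + η := (ENNReal.ofReal_lt_ofReal_iff (by positivity)).1 halt
  refine (h a ha hadm).trans ?_
  have hexp : (1 + a) / (2 + a) ≤ (1 + (w + η)) / (2 + (w + η)) := by
    rw [div_le_div_iff₀ (by positivity) (by positivity)]
    nlinarith
  gcongr

end PCZ

theorem mainTheorem2 {X Y Ω : Type*} [MeasurableSpace Y] [MeasurableSpace Ω]
    (d : ℕ) (hd : 0 < d)
    (D : X × Y → X × Y → ℝ) (hD : PCZ.IsSimilarity D)
    (hDmeas : ∀ (x : X) (z : X × Y), Measurable fun y : Y => D (x, y) z)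
    (μ : X × Y → Fin d → ℝ) (hμmeas : ∀ x : X, Measurable fun y : Y => μ (x, y))
    (hLip : ∀ (i : Fin d) (z z' : X × Y), |μ z i - μ z' i| ≤ D z z')
    (z₀ : X × Y) (T : ℕ) (hT : 0 < T) (x : ℕ → X) (ν : Measure Y)
    (P : Measure Ω) [IsProbabilityMeasure P]
    (y : ℕ → Ω → Y) (κ : ℕ → Ω → Fin d → ℝ) (b : ℕ → Ω → ℕ)
    (hrun : PCZ.IsRun D μ z₀ T (1 / (T : ℝ)) x ν P y κ b)
    (p : ℝ) (hp : 0 < p) :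
    ∫⁻ ω, PCZ.regret μ T x (fun t => y t ω) ∂P ≤
      ENNReal.ofReal
        ((28 + 112 * p *
            Real.log (2 * √2 * (d : ℝ) * (T : ℝ) ^ (5 / 2 : ℝ) * Real.exp 1)) *
          (T : ℝ) ^ PCZ.regretExponent (PCZ.zoomingDim D μ p)) +
      PCZ.maxGap μ := by

  rcases eq_or_ne (PCZ.maxGap μ) ⊤ with htop | htop
  · rw [htop, add_top]
    exact le_top
  have hfin : ∀ z, PCZ.gap μ z ≠ ⊤ := fun z =>
    ne_top_of_le_ne_top htop (le_iSup (PCZ.gap μ) z)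
  have hQ := PCZ.one_le_logArg hd hT
  set L := Real.log (2 * √2 * (d : ℝ) * (T : ℝ) ^ (5 / 2 : ℝ) * Real.exp 1) with hL
  have hLeq : L = Real.log (2 * √2 * (d : ℝ) * (T : ℝ) ^ (5 / 2 : ℝ)) + 1 := by
    rw [hL, Real.log_mul (by linarith) (Real.exp_ne_zero 1), Real.log_exp]
  have hL1 : 1 ≤ L := by
    have := Real.log_nonneg hQ
    linarith
  have hA : PCZ.confA d T (1 / (T : ℝ)) = 2 * L - 1 := by
    rw [PCZ.confA_one_div hT, hLeq]
    ring
  have hpL : 0 ≤ p * L := by positivity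
  -- In infinite dimension the exponent is `1`, and the trivial bound `T` suffices because all gaps
  -- are at most `1`.
  by_cases hdim : PCZ.zoomingDim D μ p = ⊤
  · refine hrun.lintegral_regret_le hd hT fun y' _ _ _ _ =>
      (PCZ.regret_le_card hd hD hLip hfin T x y').trans ?_
    rw [PCZ.regretExponent, if_pos hdim, Real.rpow_one, ← ENNReal.ofReal_natCast]
    refine ENNReal.ofReal_le_ofReal (le_mul_of_one_le_left (by positivity) ?_)
    linarith
  · refine PCZ.le_of_forall_admissible hT (by linarith) hdim fun a ha hadm =>
      hrun.lintegral_regret_le hd hT fun y' κ' b' hb hG => ?_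
    have hT' : (0 : ℝ) < T := by exact_mod_cast hT
    refine (PCZ.regret_le_of_noiseBounded (r₀ := (T : ℝ) ^ (-(1 / (2 + a)))) hd hD hLip hL1 hA hb hG
      hfin hp ha (by positivity) hadm).trans (ENNReal.ofReal_le_ofReal ?_)
    rw [PCZ.scale_balance hT ha]
    gcongr
    norm_num
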